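/- Let $d\ge 1$ and let $\mathcal X=(\mathcal X[q])_{q\in\mathbb Z^d}$ be a real-valued, zero-mean, stationary Gaussian process with autocovariance $r$, i.e. $\mathbb E\{\mathcal X[q]\mathcal X[q']\}=r[q-q']$, whose spectral density $S$, the Fourier series $S(\xi)=\sum_{q}r[q]e^{2\pi i q\cdot\xi}$ (that is, $r[q]=\int_{[-1/2,1/2]^d}S(\xi)e^{-2\pi i q\cdot\xi}\,d\xi$ for all $q$), is a $1$-periodic $C^2$ function on $\mathbb R^d$. Put $\|S\|_{C^2}=\max\{\|S\|_\infty,\|\partial_jS\|_\infty,\|\partial_j\partial_{j'}S\|_\infty: 1\le j,j'\le d\}$. Let $\Omega\subset\mathbb Z^d$ be finite and nonempty, $n_\Omega=\#\Omega$, and let $n_{\partial\Omega}=\sum_{q\in\mathbb Z^d}\sum_{j=1}^d|1_\Omega(q+e_j)-1_\Omega(q)|$ be its digital perimeter. Let $1\le K\le n_\Omega$ and let $W>0$ satisfy $K=\lceil n_\Omega W^d\rceil$ (for instance $W=(K/n_\Omega)^{1/d}$). Let $m_1,\dots,m_K$ be Slepian tapers on $\Omega$ with bandwidth $W$: an orthonormal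 family of sequences supported on $\Omega$ such that each $m_k$ maximizes $\int_{[-W/2,W/2]^d}\bigl|\sum_{q\in\Omega}m[q]e^{2\pi i q\cdot\xi}\bigr|^2d\xi$ among the unit-norm $m\in\ell^2(\mathbb Z^d)$ supported on $\Omega$ and orthogonal to $m_1,\dots,m_{k-1}$. Consider the multitaper estimator $$\widehat S^{\mathrm{mt}}(\xi)=\frac1K\sum_{k=1}^K\Bigl|\sum_{q\in\Omega}m_k[q]\,\mathcal X[q]\,e^{2\pi i q\cdot\xi}\Bigr|^2 .$$ If $d\ge2$, assume that $K\,n_{\partial\Omega}^{d/(d-1)}\ge n_\Omega$. Then, for every $\xi\in\mathbb R^d$, the mean squared error is finite and $$\mathbb E\bigl\{|\widehat S^{\mathrm{mt}}(\xi)-S(\xi)|^2\bigr\}\le C\,\|S\|_{C^2}^2\left(\frac{K^{4/d}}{n_\Omega^{4/d}}+\frac{n_{\partial\Omega}^2}{n_\Omega^{2-2/d}K^{2/d}}\Bigl[1+\log_+\Bigl(\frac{n_\Omega}{n_{\partial\Omega}}\Bigr)\Bigr]^2+\frac1K\right),$$ where $\log_+ t=\max\{0,\log t\}$ (so that $\log_+=\log$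 when $n_{\partial\Omega}\le n_\Omega$) and $C$ depends only on $d$. In particular, let $d=2$ and $A>0$. There is a constant $C$ depending only on $A$ such that, in the fine-scale regime $n_{\partial\Omega}\le A\sqrt{n_\Omega}$, whenever $n_\Omega\ge2$, $K=\lceil n_\Omega^{2/3}\rceil$ and $W>0$ satisfies $K=\lceil n_\Omega W^2\rceil$ (for instance $W=n_\Omega^{-1/6}$ or $W=(K/n_\Omega)^{1/2}$), one has for every $\xi\in\mathbb R^2$ $$\mathbb E\bigl\{|\widehat S^{\mathrm{mt}}(\xi)-S(\xi)|^2\bigr\}\le C\,n_\Omega^{-2/3}\,\log^2(n_\Omega)\,\|S\|_{C^2}^2 .$$ -/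

import Mathlib

open MeasureTheory ProbabilityTheory

namespace Multitaper

/-- The cube `[-W/2, W/2]^d`. -/
def cube (d : ℕ) (W : ℝ) : Set (Fin d → ℝ) :=
  Set.Icc (fun _ => -(W / 2)) (fun _ => W / 2)

/-- The exponential `e^{2πi q·ξ}` with integer frequency vector `q`. -/
noncomputable def expo {d : ℕ} (q : Fin d → ℤ) (ξ : Fin d → ℝ) : ℂ :=
  Complex.exp (2 * Real.pi * Complex.I * ((∑ j, (q j : ℝ) * ξ j : ℝ) : ℂ))

/-- `f` is `1`-periodic: `f (x + k) = f x` for all `k ∈ ℤ^d`. -/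
def IsOnePeriodic {d : ℕ} (f : (Fin d → ℝ) → ℝ) : Prop :=
  ∀ (x : Fin d → ℝ) (k : Fin d → ℤ), f (x + fun j => (k j : ℝ)) = f x

/-- The `L^∞`-norm of a `1`-periodic function: its essential supremum over `[-1/2, 1/2]^d`. -/
noncomputable def supNorm {d : ℕ} (f : (Fin d → ℝ) → ℝ) : ℝ :=
  (eLpNorm f ⊤ (volume.restrict (cube d 1))).toReal

/-- The partial derivative of `f` in the `j`-th coordinate direction. -/
noncomputable def partialDeriv {d : ℕ} (j : Fin d) (f : (Fin d → ℝ) → ℝ) : (Fin d → ℝ) → ℝ :=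
  fun x => fderiv ℝ f x (Pi.single j 1)

/-- The `C²`-norm: the maximum of the `L^∞`-norms of `f` and of its partial derivatives of
orders one and two. -/
noncomputable def C2Norm {d : ℕ} (f : (Fin d → ℝ) → ℝ) : ℝ :=
  max (supNorm f)
    (max (⨆ j : Fin d, supNorm (partialDeriv j f))
      (⨆ p : Fin d × Fin d, supNorm (partialDeriv p.1 (partialDeriv p.2 f))))

/-- A real-valued, zero-mean, stationary Gaussian process on `ℤ^d` with autocovariance function
`r`: `𝔼 (X[q] X[q']) = r[q - q']`. -/
structure IsStationaryGaussian {d : ℕ} {E : Type*} [MeasurableSpace E] (P : Measure E)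
    (X : (Fin d → ℤ) → E → ℝ) (r : (Fin d → ℤ) → ℝ) : Prop where
  gaussian : IsGaussianProcess X P
  mean_zero : ∀ q, ∫ ω, X q ω ∂P = 0
  covariance : ∀ q q', ∫ ω, X q ω * X q' ω ∂P = r (q - q')

/-- `S` is the Fourier series `∑_q r[q] e^{2πi q·ξ}` of the autocovariance function `r`, in the
sense that `r[q]` is the `q`-th Fourier coefficient of `S`. (When `r` is absolutely summable and
`S` is continuous and `1`-periodic, this says that the series converges to `S` at every point; no
summability of `r` is required here.) -/
structure IsSpectralDensity {d : ℕ} (S : (Fin d → ℝ) → ℝ) (r : (Fin d → ℤ) → ℝ) : Prop where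
  integrable : IntegrableOn S (cube d 1)
  coeff : ∀ q, (r q : ℂ) = ∫ ξ in cube d 1, (S ξ : ℂ) * expo (-q) ξ

/-- The digital perimeter `∑_q ∑_j |1_Ω(q + e_j) - 1_Ω(q)|`. -/
noncomputable def digitalPerimeter {d : ℕ} (Ω : Finset (Fin d → ℤ)) : ℝ :=
  ∑' q : Fin d → ℤ, ∑ j : Fin d,
    |Set.indicator (↑Ω : Set (Fin d → ℤ)) (fun _ => (1 : ℝ)) (q + Pi.single j 1)
      - Set.indicator (↑Ω : Set (Fin d → ℤ)) (fun _ => (1 : ℝ)) q|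

/-- The spectral concentration `∫_{[-W/2,W/2]^d} |∑_{q ∈ Ω} m[q] e^{2πi q·ξ}|² dξ`. -/
noncomputable def concentration {d : ℕ} (Ω : Finset (Fin d → ℤ)) (W : ℝ)
    (m : (Fin d → ℤ) → ℂ) : ℝ :=
  ∫ ξ in cube d W, ‖∑ q ∈ Ω, m q * expo q ξ‖ ^ 2

/-- `m_1, …, m_K` are Slepian tapers on `Ω` with bandwidth `W`: they are orthonormal sequences
supported on `Ω`, and each `m_k` maximizes the spectral concentration among all sequences of unit
norm supported on `Ω` that are orthogonal to the preceding tapers. -/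
structure IsSlepianTapers {d : ℕ} (Ω : Finset (Fin d → ℤ)) (W : ℝ) {K : ℕ}
    (m : Fin K → (Fin d → ℤ) → ℂ) : Prop where
  support : ∀ k, ∀ q ∉ Ω, m k q = 0
  orthonormal : ∀ k l, ∑ q ∈ Ω, m k q * starRingEnd ℂ (m l q) = if k = l then 1 else 0
  maximal : ∀ k, ∀ f : (Fin d → ℤ) → ℂ, (∀ q ∉ Ω, f q = 0) → ∑ q ∈ Ω, ‖f q‖ ^ 2 = 1 →
    (∀ l < k, ∑ q ∈ Ω, f q * starRingEnd ℂ (m l q) = 0) →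
    concentration Ω W f ≤ concentration Ω W (m k)

/-- The tapered periodogram `|∑_{q ∈ Ω} m[q] x[q] e^{2πi q·ξ}|²` of the realization `x`. -/
noncomputable def taperedPeriodogram {d : ℕ} (Ω : Finset (Fin d → ℤ)) (m : (Fin d → ℤ) → ℂ)
    (x : (Fin d → ℤ) → ℝ) (ξ : Fin d → ℝ) : ℝ :=
  ‖∑ q ∈ Ω, m q * (x q : ℂ) * expo q ξ‖ ^ 2

/-- The multitaper estimator: the average of the `K` tapered periodograms. -/
noncomputable def multitaper {d : ℕ} (Ω : Finset (Fin d → ℤ)) {K : ℕ}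
    (m : Fin K → (Fin d → ℤ) → ℂ) (x : (Fin d → ℤ) → ℝ) (ξ : Fin d → ℝ) : ℝ :=
  (1 / (K : ℝ)) * ∑ k : Fin K, taperedPeriodogram Ω (m k) x ξ

/-- The squared error `|Ŝ(ξ) - S(ξ)|²` of the multitaper estimator, as a random variable. -/
noncomputable def sqError {d : ℕ} {E : Type*} (X : (Fin d → ℤ) → E → ℝ)
    (S : (Fin d → ℝ) → ℝ) (Ω : Finset (Fin d → ℤ)) {K : ℕ} (m : Fin K → (Fin d → ℤ) → ℂ)
    (ξ : Fin d → ℝ) : E → ℝ :=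
  fun ω => |multitaper Ω m (fun q => X q ω) ξ - S ξ| ^ 2

end Multitaper

/-! The squared error splits into bias and variance. The mean of the estimator is S convolved with
the window ρ = (1/K) ∑ |m̂_k|², where m̂_k is the trigonometric polynomial of m_k. Bessel's
inequality gives ∑ |m̂_k|² ≤ n_Ω, hence ρ ≤ W^(-d), because n_Ω W^d ≤ K. So on Q = [-W/2, W/2]^d the
window lies below W^(-d) 1_Q, which also has mass one, and the L¹ distance of the two is twice the
deficiency 1 - ∫_Q ρ. Averaging S over Q costs O(W²), since first-order terms cancel by symmetry
(`abs_integral_window_sub_le`).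

The deficiency equals (1/K) ∑ (1 - λ_k), where λ_k is the Rayleigh quotient at m_k of the Toeplitz
operator T on Ω with symbol 1_Q. As tr T = n_Ω W^d is within one of K, a variational argument bounds
∑ (1 - λ_k) by 1 + tr (T - T²) (`sum_one_sub_rayleigh_le`). Parseval rewrites this trace as ∑_h
|c(h)|² #{q ∈ Ω : q - h ∉ Ω}, with c the Fourier coefficients of 1_Q. The count is at most ∑_j
min(n_Ω, |h_j| n_∂Ω), and the one-dimensional coefficients are at most 1/|h_j|, so a truncated
harmonic series remains: this is the source of the logarithm (`sum_sub_norm_cubeCoeff_le`).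

For the variance, Isserlis' formula leaves a sum of squared covariances of the real and imaginary
parts of the tapered sums. Bessel's inequality and the bound ‖S‖_∞ on the covariance operator make
it at most 2‖S‖²/K (`sum_linCov_sq_le`). Finally W ≤ (K/n_Ω)^(1/d) expresses everything through K
and n_Ω; the extra 1 in the deficiency contributes O(1/K²) to the squared bias, which 1/K absorbs.
-/

namespace Multitaper

variable {d : ℕ}

/-! ### Cubes, periodic functions and the C² norm -/

lemma mem_cube {W : ℝ} {x : Fin d → ℝ} : x ∈ cube d W ↔ ∀ j, |x j| ≤ W / 2 := by
  simp only [cube, Set.mem_Icc, Pi.le_def, abs_le, forall_and]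

lemma cube_eq_closedBall {W : ℝ} (hW : 0 ≤ W) :
    cube d W = Metric.closedBall (0 : Fin d → ℝ) (W / 2) := by
  ext x
  rw [mem_cube, mem_closedBall_zero_iff, pi_norm_le_iff_of_nonneg (by positivity)]
  simp only [Real.norm_eq_abs]

lemma isCompact_cube (W : ℝ) : IsCompact (cube d W) := isCompact_Icc

lemma measurableSet_cube (W : ℝ) : MeasurableSet (cube d W) := measurableSet_Icc

lemma volume_real_cube {W : ℝ} (hW : 0 ≤ W) : volume.real (cube d W) = W ^ d := by
  rw [measureReal_def, cube, Real.volume_Icc_pi_toReal]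
  · simp
  · intro j; simp only; linarith

lemma exists_add_int_mem_cube (x : Fin d → ℝ) :
    ∃ k : Fin d → ℤ, (x + fun j => (k j : ℝ)) ∈ cube d 1 := by
  refine ⟨fun j => -round (x j), mem_cube.2 fun j => ?_⟩
  simpa [sub_eq_add_neg] using abs_sub_round (x j)

/-- A continuous periodic function is bounded everywhere by its essential supremum. -/
lemma abs_le_supNorm {f : (Fin d → ℝ) → ℝ} (hf : Continuous f) (hp : IsOnePeriodic f)
    (x : Fin d → ℝ) : |f x| ≤ supNorm f := by
  obtain ⟨k, hk⟩ := exists_add_int_mem_cube x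
  rw [← hp x k]
  generalize (x + fun j => (k j : ℝ)) = y at hk
  obtain ⟨B, hB⟩ := (isCompact_cube (d := d) 1).exists_bound_of_continuousOn hf.continuousOn
  -- Finiteness is essential: `toReal` would send an infinite essential supremum to 0.
  have hfin : eLpNormEssSup f (volume.restrict (cube d 1)) ≠ ⊤ :=
    (eLpNormEssSup_lt_top_of_ae_bound
      ((ae_restrict_iff' (measurableSet_cube 1)).2 (.of_forall hB))).ne
  have hae : ∀ᵐ z ∂volume.restrict (cube d 1), |f z| ≤ supNorm f := by
    filter_upwards [ae_le_eLpNormEssSup (f := f) (μ := volume.restrict (cube d 1))] with z hz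
    have := ENNReal.toReal_mono hfin hz
    simpa [supNorm] using this
  rw [cube_eq_closedBall zero_le_one] at hk hae
  -- A nonempty open set has positive measure, so the almost-everywhere bound holds everywhere on
  -- the open cube; closure then reaches the faces.
  have hball : Metric.ball (0 : Fin d → ℝ) (1 / 2) ⊆ {z | |f z| ≤ supNorm f} := by
    have hopen : IsOpen (Metric.ball (0 : Fin d → ℝ) (1 / 2) ∩ {z | supNorm f < |f z|}) :=
      Metric.isOpen_ball.inter (isOpen_lt continuous_const hf.abs)
    have hz : volume (Metric.ball (0 : Fin d → ℝ) (1 / 2) ∩ {z | supNorm f < |f z|}) = 0 := by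
      rw [ae_restrict_iff' measurableSet_closedBall, ae_iff] at hae
      refine measure_mono_null (fun z hz => ?_) hae
      simp only [Set.mem_ofPred_eq, Classical.not_imp, not_le]
      exact ⟨Metric.ball_subset_closedBall hz.1, hz.2⟩
    rw [hopen.measure_eq_zero_iff (μ := volume)] at hz
    intro z hzb
    by_contra hcon
    exact (Set.eq_empty_iff_forall_notMem.1 hz z) ⟨hzb, by simpa using hcon⟩
  have hcl : closure (Metric.ball (0 : Fin d → ℝ) (1 / 2)) ⊆ {z | |f z| ≤ supNorm f} :=
    closure_minimal hball (isClosed_le hf.abs continuous_const)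
  rw [closure_ball _ (by norm_num)] at hcl
  exact hcl hk

lemma IsOnePeriodic.partialDeriv {f : (Fin d → ℝ) → ℝ} (hp : IsOnePeriodic f) (j : Fin d) :
    IsOnePeriodic (partialDeriv j f) := by
  intro x k
  have h : (fun y => f (y + fun j => (k j : ℝ))) = f := funext fun y => hp y k
  simp only [Multitaper.partialDeriv]
  rw [← fderiv_comp_add_right, h]

lemma contDiff_partialDeriv {f : (Fin d → ℝ) → ℝ} {n : ℕ} (hf : ContDiff ℝ (n + 1 : ℕ) f)
    (j : Fin d) : ContDiff ℝ n (partialDeriv j f) := by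
  have h : ContDiff ℝ n (fderiv ℝ f) := hf.fderiv_right (by norm_cast)
  exact h.clm_apply contDiff_const

lemma abs_le_C2Norm {f : (Fin d → ℝ) → ℝ} (hf : ContDiff ℝ 2 f) (hp : IsOnePeriodic f)
    (x : Fin d → ℝ) : |f x| ≤ C2Norm f :=
  (abs_le_supNorm hf.continuous hp x).trans (le_max_left _ _)

lemma C2Norm_nonneg {f : (Fin d → ℝ) → ℝ} : 0 ≤ C2Norm f :=
  le_trans ENNReal.toReal_nonneg (le_max_left _ _)

lemma abs_partialDeriv_partialDeriv_le_C2Norm {f : (Fin d → ℝ) → ℝ} (hf : ContDiff ℝ 2 f)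
    (hp : IsOnePeriodic f) (i j : Fin d) (x : Fin d → ℝ) :
    |partialDeriv i (partialDeriv j f) x| ≤ C2Norm f := by
  have h1 : ContDiff ℝ 1 (partialDeriv j f) := contDiff_partialDeriv (n := 1) hf j
  have h2 : ContDiff ℝ 0 (partialDeriv i (partialDeriv j f)) :=
    contDiff_partialDeriv (n := 0) h1 i
  refine (abs_le_supNorm h2.continuous ((hp.partialDeriv j).partialDeriv i) x).trans ?_
  refine le_trans ?_ ((le_max_right _ _).trans (le_max_right _ _))
  exact le_ciSup (f := fun p : Fin d × Fin d =>
    supNorm (partialDeriv p.1 (partialDeriv p.2 f))) (Set.finite_range _).bddAbove (i, j)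

/-- The domain carries the sup norm, so expanding in the basis costs a factor d. It is used for both
the gradient and the Hessian, whence the d² in the bias. -/
lemma opNorm_le_of_single {L : (Fin d → ℝ) →L[ℝ] ℝ} {B : ℝ} (hB : 0 ≤ B)
    (h : ∀ j, |L (Pi.single j 1)| ≤ B) : ‖L‖ ≤ d * B := by
  refine L.opNorm_le_bound (by positivity) fun v => ?_
  have hv : v = ∑ j, v j • (Pi.single j 1 : Fin d → ℝ) := by
    simpa using (pi_eq_sum_univ' v)
  conv_lhs => rw [hv]
  rw [map_sum]
  refine (norm_sum_le _ _).trans ?_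
  have : ∀ j ∈ Finset.univ, ‖L (v j • (Pi.single j 1 : Fin d → ℝ))‖ ≤ B * ‖v‖ := by
    intro j _
    rw [map_smul, norm_smul, mul_comm]
    exact mul_le_mul (h j) (norm_le_pi_norm v j) (norm_nonneg _) hB
  refine (Finset.sum_le_sum this).trans (le_of_eq ?_)
  simp [mul_assoc]

/-- The symmetric second difference of a periodic `C²` function. -/
lemma abs_second_difference_le {f : (Fin d → ℝ) → ℝ} (hf : ContDiff ℝ 2 f)
    (hp : IsOnePeriodic f) (ξ x : Fin d → ℝ) :
    |f (ξ + x) + f (ξ - x) - 2 * f ξ| ≤ 2 * d ^ 2 * C2Norm f * ‖x‖ ^ 2 := by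
  have hM : 0 ≤ C2Norm f := C2Norm_nonneg
  have hlip : ∀ (j : Fin d) (y z : Fin d → ℝ),
      |partialDeriv j f y - partialDeriv j f z| ≤ d * C2Norm f * ‖y - z‖ := by
    intro j y z
    have h1 : ContDiff ℝ 1 (partialDeriv j f) := contDiff_partialDeriv (n := 1) hf j
    refine convex_univ.norm_image_sub_le_of_norm_fderiv_le (𝕜 := ℝ) (f := partialDeriv j f)
      (fun w _ => (h1.differentiable one_ne_zero) w) (fun w _ => ?_) (Set.mem_univ z)
      (Set.mem_univ y)
    exact opNorm_le_of_single hM fun i => abs_partialDeriv_partialDeriv_le_C2Norm hf hp i j w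
  have hd : Differentiable ℝ f := hf.differentiable two_ne_zero
  -- The gradient of the symmetrized function at y is a difference of gradients of f at points 2y
  -- apart, hence O(‖y‖). The mean value inequality on a ball supplies the second factor ‖x‖.
  set g : (Fin d → ℝ) → ℝ := fun y => f (ξ + y) + f (ξ - y)
  have hg : ∀ y, HasFDerivAt g (fderiv ℝ f (ξ + y) - fderiv ℝ f (ξ - y)) y := by
    intro y
    have h1 : HasFDerivAt (fun y => f (ξ + y)) (fderiv ℝ f (ξ + y)) y := by
      have := (hd (ξ + y)).hasFDerivAt.comp y ((hasFDerivAt_id y).const_add ξ)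
      exact this
    have h2 : HasFDerivAt (fun y => f (ξ - y)) (-fderiv ℝ f (ξ - y)) y := by
      have := (hd (ξ - y)).hasFDerivAt.comp y ((hasFDerivAt_id y).const_sub ξ)
      refine this.congr_fderiv ?_
      ext v; simp
    rw [sub_eq_add_neg]
    exact h1.add h2
  have hbound : ∀ y ∈ Metric.closedBall (0 : Fin d → ℝ) ‖x‖,
      ‖fderiv ℝ f (ξ + y) - fderiv ℝ f (ξ - y)‖ ≤ d * (d * C2Norm f * (2 * ‖x‖)) := by
    intro y hy
    refine opNorm_le_of_single (by positivity) fun j => ?_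
    refine (hlip j (ξ + y) (ξ - y)).trans ?_
    gcongr
    rw [mem_closedBall_zero_iff] at hy
    calc ‖ξ + y - (ξ - y)‖ = ‖y + y‖ := by congr 1; abel
      _ ≤ ‖y‖ + ‖y‖ := norm_add_le _ _
      _ ≤ 2 * ‖x‖ := by linarith
  have := (convex_closedBall (0 : Fin d → ℝ) ‖x‖).norm_image_sub_le_of_norm_hasFDerivWithin_le
    (fun y _ => (hg y).hasFDerivWithinAt) hbound
    (Metric.mem_closedBall_self (norm_nonneg x)) (mem_closedBall_zero_iff.2 le_rfl)
  simp only [g, add_zero, sub_zero, Real.norm_eq_abs] at this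
  calc _ = |f (ξ + x) + f (ξ - x) - (f ξ + f ξ)| := by ring_nf
    _ ≤ _ := this
    _ = _ := by ring

open scoped Pointwise in
/-- Integrals of periodic functions over translated and reflected unit cubes agree. -/
lemma setIntegral_cube_one_comp_sub {F : Type*} [NormedAddCommGroup F] [NormedSpace ℝ F]
    {f : (Fin d → ℝ) → F}
    (hp : ∀ (x : Fin d → ℝ) (k : Fin d → ℤ), f (x + fun j => (k j : ℝ)) = f x)
    (ξ : Fin d → ℝ) :
    ∫ η in cube d 1, f (ξ - η) = ∫ η in cube d 1, f η := by
  -- Every unit box is, up to a null set, a translate of the fundamental domain of ℤ^d, so all of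
  -- them give a periodic function the same integral.
  have key : ∀ v : Fin d → ℝ, ∫ η in Set.Icc v (v + 1), f η
      = ∫ η in ZSpan.fundamentalDomain (Pi.basisFun ℝ (Fin d)), f η := by
    intro v
    have hF := ZSpan.isAddFundamentalDomain (Pi.basisFun ℝ (Fin d)) volume
    have hinv : ∀ (g : Submodule.span ℤ (Set.range (Pi.basisFun ℝ (Fin d)))) (x : Fin d → ℝ),
        f (g +ᵥ x) = f x := by
      intro g x
      have hg := ((Pi.basisFun ℝ (Fin d)).mem_span_iff_repr_mem ℤ (g : Fin d → ℝ)).1 g.2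
      choose k hk using hg
      have : (g : Fin d → ℝ) = fun j => (k j : ℝ) := by
        ext j; simpa using (hk j).symm
      rw [Submodule.vadd_def, vadd_eq_add, this, add_comm, hp]
    have : VAddInvariantMeasure (Submodule.span ℤ (Set.range (Pi.basisFun ℝ (Fin d))))
        (Fin d → ℝ) volume :=
      inferInstanceAs (VAddInvariantMeasure
        (Submodule.span ℤ (Set.range (Pi.basisFun ℝ (Fin d)))).toAddSubgroup (Fin d → ℝ) volume)
    have hv := hF.vadd_of_comm v
    rw [← hv.setIntegral_eq hF hinv]
    refine setIntegral_congr_set ?_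
    have h1 : v +ᵥ ZSpan.fundamentalDomain (Pi.basisFun ℝ (Fin d))
        = Set.pi Set.univ fun j => Set.Ico (v j) ((v + 1) j) := by
      rw [ZSpan.fundamentalDomain_pi_basisFun]
      ext x
      simp only [Set.mem_vadd_set_iff_neg_vadd_mem, Set.mem_pi, Set.mem_univ, true_imp_iff,
        vadd_eq_add, Pi.add_apply, Pi.neg_apply, Pi.one_apply, Set.mem_Ico]
      refine forall_congr' fun j => ?_
      constructor <;> rintro ⟨h1, h2⟩ <;> constructor <;> linarith
    rw [h1]
    exact Measure.univ_pi_Ico_ae_eq_Icc.symm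
  have h2 : ∫ η in cube d 1, f (ξ - η) =
      ∫ η in Set.Icc (ξ - fun _ => 1 / 2) ((ξ - fun _ => 1 / 2) + 1), f η := by
    have hmp : MeasurePreserving (fun η : Fin d → ℝ => ξ - η) volume volume :=
      Measure.measurePreserving_sub_left volume ξ
    have hemb : MeasurableEmbedding (fun η : Fin d → ℝ => ξ - η) :=
      (MeasurableEquiv.subLeft ξ).measurableEmbedding
    rw [← hmp.setIntegral_preimage_emb hemb f]
    congr 2
    ext η
    simp only [cube, Set.mem_Icc, Set.mem_preimage, Pi.le_def, Pi.sub_apply, Pi.add_apply,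
      Pi.one_apply, ← forall_and]
    refine forall_congr' fun j => ?_
    constructor <;> rintro ⟨h1, h2⟩ <;> constructor <;> linarith
  have h3 : cube d 1 = Set.Icc (fun _ => -(1 / 2)) ((fun _ => -(1 / 2)) + 1) := by
    simp only [cube]
    congr 1
    ext j; simp; norm_num
  rw [h2, key, h3, key]

/-! ### Exponentials and Fourier coefficients of cubes -/

lemma expo_add (q q' : Fin d → ℤ) (ξ : Fin d → ℝ) : expo (q + q') ξ = expo q ξ * expo q' ξ := by
  simp only [expo, ← Complex.exp_add]
  congr 1
  simp only [Pi.add_apply, Int.cast_add, add_mul, Finset.sum_add_distrib]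
  push_cast
  ring

lemma expo_neg (q : Fin d → ℤ) (ξ : Fin d → ℝ) : expo (-q) ξ = starRingEnd ℂ (expo q ξ) := by
  simp only [expo, ← Complex.exp_conj]
  congr 1
  simp only [map_mul, Complex.conj_ofReal, Complex.conj_I, map_ofNat, Pi.neg_apply, Int.cast_neg,
    neg_mul, Finset.sum_neg_distrib]
  push_cast
  ring

lemma expo_sub (q q' : Fin d → ℤ) (ξ : Fin d → ℝ) :
    expo (q - q') ξ = expo q ξ * starRingEnd ℂ (expo q' ξ) := by
  rw [sub_eq_add_neg, expo_add, expo_neg]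

lemma expo_arg_sub (q : Fin d → ℤ) (ξ η : Fin d → ℝ) :
    expo q (ξ - η) = expo q ξ * starRingEnd ℂ (expo q η) := by
  rw [← expo_neg]
  simp only [expo, ← Complex.exp_add]
  congr 1
  simp only [Pi.neg_apply, Int.cast_neg, Pi.sub_apply, mul_sub, Finset.sum_sub_distrib, neg_mul,
    Finset.sum_neg_distrib]
  push_cast
  ring

lemma norm_expo (q : Fin d → ℤ) (ξ : Fin d → ℝ) : ‖expo q ξ‖ = 1 := by
  rw [expo, show (2 * Real.pi * Complex.I * ((∑ j, (q j : ℝ) * ξ j : ℝ) : ℂ))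
    = ((2 * Real.pi * ∑ j, (q j : ℝ) * ξ j : ℝ) : ℂ) * Complex.I by push_cast; ring]
  exact Complex.norm_exp_ofReal_mul_I _

lemma continuous_expo (q : Fin d → ℤ) : Continuous (expo q) := by
  unfold expo
  fun_prop

lemma expo_eq_prod (q : Fin d → ℤ) (ξ : Fin d → ℝ) :
    expo q ξ = ∏ j, Complex.exp (2 * Real.pi * Complex.I * q j * ξ j) := by
  rw [expo, ← Complex.exp_sum]
  congr 1
  push_cast
  rw [Finset.mul_sum]
  exact Finset.sum_congr rfl fun j _ => by ring

lemma expo_periodic (q : Fin d → ℤ) (ξ : Fin d → ℝ) (k : Fin d → ℤ) :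
    expo q (ξ + fun j => (k j : ℝ)) = expo q ξ := by
  rw [expo_eq_prod, expo_eq_prod]
  refine Finset.prod_congr rfl fun j _ => ?_
  rw [Complex.exp_eq_exp_iff_exists_int]
  refine ⟨q j * k j, ?_⟩
  simp only [Pi.add_apply]
  push_cast
  ring

/-- The Fourier coefficients of the interval `[-W/2, W/2]`. -/
noncomputable def intervalCoeff (W : ℝ) (h : ℤ) : ℂ :=
  ∫ x in Set.Icc (-(W / 2)) (W / 2), Complex.exp (2 * Real.pi * Complex.I * h * x)

/-- The Fourier coefficients of the cube `[-W/2, W/2]^d`. -/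
noncomputable def cubeCoeff (W : ℝ) (q : Fin d → ℤ) : ℂ :=
  ∫ ξ in cube d W, expo q ξ

lemma cubeCoeff_eq_prod (W : ℝ) (q : Fin d → ℤ) :
    cubeCoeff W q = ∏ j, intervalCoeff W (q j) := by
  have h : (volume.restrict (cube d W) : Measure (Fin d → ℝ))
      = Measure.pi fun _ => volume.restrict (Set.Icc (-(W / 2)) (W / 2)) := by
    rw [cube, ← Set.pi_univ_Icc, volume_pi, Measure.restrict_pi_pi]
  simp only [cubeCoeff, intervalCoeff, expo_eq_prod]
  rw [h, integral_fintype_prod_eq_prod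
    (f := fun j (x : ℝ) => Complex.exp (2 * Real.pi * Complex.I * q j * x))]

lemma intervalCoeff_eq {W : ℝ} (hW : 0 ≤ W) (h : ℤ) :
    intervalCoeff W h = ∫ x in (-(W / 2))..(W / 2), Complex.exp (2 * Real.pi * Complex.I * h * x) := by
  rw [intervalCoeff, integral_Icc_eq_integral_Ioc,
    intervalIntegral.integral_of_le (by linarith)]

lemma intervalCoeff_zero {W : ℝ} (hW : 0 ≤ W) : intervalCoeff W 0 = W := by
  rw [intervalCoeff_eq hW]
  simp only [Int.cast_zero, mul_zero, zero_mul, Complex.exp_zero, intervalIntegral.integral_const,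
    sub_neg_eq_add, add_halves]
  simp

lemma intervalCoeff_of_ne_zero {W : ℝ} (hW : 0 ≤ W) {h : ℤ} (hh : h ≠ 0) :
    intervalCoeff W h = (Complex.exp (2 * Real.pi * Complex.I * h * (W / 2 : ℝ))
      - Complex.exp (2 * Real.pi * Complex.I * h * (-(W / 2) : ℝ))) /
        (2 * Real.pi * Complex.I * h) := by
  have hh' : (h : ℂ) ≠ 0 := by exact_mod_cast hh
  rw [intervalCoeff_eq hW, integral_exp_mul_complex]
  simp [hh, Real.pi_ne_zero]

/-- The coefficient is a difference of two unit exponentials over 2πih, so its modulus is at most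
1/(π|h|). The bound is uniform in W. -/
lemma norm_intervalCoeff_sq_le {W : ℝ} (hW : 0 ≤ W) {h : ℤ} (hh : h ≠ 0) :
    ‖intervalCoeff W h‖ ^ 2 ≤ 1 / (h : ℝ) ^ 2 := by
  have hexp : ∀ x : ℝ, ‖Complex.exp (2 * Real.pi * Complex.I * h * x)‖ = 1 := by
    intro x
    rw [show (2 * Real.pi * Complex.I * h * x : ℂ)
      = ((2 * Real.pi * h * x : ℝ) : ℂ) * Complex.I by push_cast; ring]
    exact Complex.norm_exp_ofReal_mul_I _
  have h0 : (0 : ℝ) < |(h : ℝ)| := abs_pos.2 (by exact_mod_cast hh)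
  have h1 : ‖intervalCoeff W h‖ ≤ 1 / |(h : ℝ)| := by
    rw [intervalCoeff_of_ne_zero hW hh, norm_div]
    have hden : ‖(2 * Real.pi * Complex.I * h : ℂ)‖ = 2 * Real.pi * |(h : ℝ)| := by
      simp [abs_of_pos Real.pi_pos]
    rw [hden, div_le_div_iff₀ (by positivity) h0]
    have h2 := norm_sub_le (Complex.exp (2 * Real.pi * Complex.I * h * (W / 2 : ℝ)))
      (Complex.exp (2 * Real.pi * Complex.I * h * (-(W / 2) : ℝ)))
    rw [hexp, hexp] at h2
    have hpi := Real.pi_gt_three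
    nlinarith
  calc ‖intervalCoeff W h‖ ^ 2 ≤ (1 / |(h : ℝ)|) ^ 2 := by gcongr
    _ = _ := by rw [div_pow, sq_abs, one_pow]

lemma intervalCoeff_one {h : ℤ} (hh : h ≠ 0) : intervalCoeff 1 h = 0 := by
  rw [intervalCoeff_of_ne_zero zero_le_one hh, div_eq_zero_iff, sub_eq_zero]
  left
  rw [Complex.exp_eq_exp_iff_exists_int]
  refine ⟨h, ?_⟩
  push_cast
  ring

lemma cubeCoeff_one (q : Fin d → ℤ) : cubeCoeff 1 q = if q = 0 then 1 else 0 := by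
  rw [cubeCoeff_eq_prod]
  split_ifs with hq
  · subst hq
    simp [intervalCoeff_zero]
  · obtain ⟨j, hj⟩ := Function.ne_iff.1 hq
    exact Finset.prod_eq_zero (Finset.mem_univ j) (intervalCoeff_one hj)

lemma cubeCoeff_zero {W : ℝ} (hW : 0 ≤ W) : cubeCoeff W (0 : Fin d → ℤ) = (W : ℂ) ^ d := by
  rw [cubeCoeff_eq_prod]
  simp [intervalCoeff_zero hW]

/-- Parseval's identity for the interval `[-W/2, W/2]`. -/
lemma hasSum_norm_intervalCoeff_sq {W : ℝ} (hW : 0 < W) (hW1 : W ≤ 1) :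
    HasSum (fun h => ‖intervalCoeff W h‖ ^ 2) W := by
  have hab : (-(1 / 2) : ℝ) < 1 / 2 := by norm_num
  set I := Set.Ioc (-(W / 2)) (W / 2)
  have hI : I ⊆ Set.Ioc (-(1 / 2) : ℝ) (1 / 2) :=
    Set.Ioc_subset_Ioc (by linarith) (by linarith)
  set f : ℝ → ℂ := I.indicator fun _ => 1
  have hmem : MemLp f 2 (volume.restrict (Set.Ioc (-(1 / 2) : ℝ) (1 / 2))) :=
    (memLp_const 1).indicator measurableSet_Ioc
  have hset : ∀ g : ℝ → ℂ, (∫ x in (-(1 / 2) : ℝ)..(1 / 2), I.indicator g x)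
      = ∫ x in (-(W / 2))..(W / 2), g x := by
    intro g
    rw [intervalIntegral.integral_of_le hab.le, setIntegral_indicator measurableSet_Ioc,
      Set.inter_eq_self_of_subset_right hI, intervalIntegral.integral_of_le (by linarith)]
  -- The Fourier coefficient carries the opposite sign convention; the final reindexing by
  -- `Equiv.neg` undoes it.
  have hcoef : ∀ n : ℤ, fourierCoeffOn hab f n = intervalCoeff W (-n) := by
    intro n
    have : ∀ x : ℝ, (fourier (-n) (x : AddCircle ((1 / 2 : ℝ) - -(1 / 2)))) • f x
        = I.indicator (fun x : ℝ => Complex.exp (2 * Real.pi * Complex.I * (-n : ℤ) * x)) x := by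
      intro x
      by_cases hx : x ∈ I
      · simp only [f, Set.indicator_of_mem hx, smul_eq_mul, mul_one, fourier_coe_apply]
        congr 1
        norm_num
      · simp [f, Set.indicator_of_notMem hx]
    rw [fourierCoeffOn_eq_integral]
    simp only [this]
    rw [hset, intervalCoeff_eq hW.le]
    norm_num
  have hsum := hasSum_sq_fourierCoeffOn hab hmem
  have hval : ((1 / 2 : ℝ) - -(1 / 2))⁻¹ • (∫ x in (-(1 / 2) : ℝ)..(1 / 2), ‖f x‖ ^ 2) = W := by
    have : ∀ x, ‖f x‖ ^ 2 = I.indicator (fun _ => (1 : ℝ)) x := by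
      intro x
      by_cases hx : x ∈ I <;> simp [f, hx]
    simp only [this]
    rw [intervalIntegral.integral_of_le hab.le, setIntegral_indicator measurableSet_Ioc,
      Set.inter_eq_self_of_subset_right hI, ← intervalIntegral.integral_of_le (by linarith)]
    simp
    norm_num
  rw [hval] at hsum
  simp only [hcoef] at hsum
  exact (Equiv.neg ℤ).hasSum_iff.1 hsum

/-! ### The logarithmic sum -/

/-- The measure on `ℤ` with weights the squared Fourier coefficients of `[-W/2, W/2]`. -/
noncomputable def coeffMeasure (W : ℝ) : Measure ℤ :=
  Measure.sum fun h => ENNReal.ofReal (‖intervalCoeff W h‖ ^ 2) • Measure.dirac h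

lemma coeffMeasure_singleton (W : ℝ) (h : ℤ) :
    coeffMeasure W {h} = ENNReal.ofReal (‖intervalCoeff W h‖ ^ 2) := by
  rw [coeffMeasure, Measure.sum_apply _ (measurableSet_singleton h), tsum_eq_single h]
  · simp
  · intro b hb
    simp [hb]

lemma coeffMeasure_univ {W : ℝ} (hW : 0 < W) (hW1 : W ≤ 1) :
    coeffMeasure W Set.univ = ENNReal.ofReal W := by
  have h := hasSum_norm_intervalCoeff_sq hW hW1
  rw [coeffMeasure, Measure.sum_apply _ MeasurableSet.univ]
  conv_rhs => rw [← h.tsum_eq, ENNReal.ofReal_tsum_of_nonneg (fun _ => by positivity) h.summable]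
  simp

lemma isFiniteMeasure_coeffMeasure {W : ℝ} (hW : 0 < W) (hW1 : W ≤ 1) :
    IsFiniteMeasure (coeffMeasure W) :=
  ⟨by rw [coeffMeasure_univ hW hW1]; exact ENNReal.ofReal_lt_top⟩

/-- Below R the terms are 1/i and give a harmonic sum, at most 1 + log R. Above R the tail of ∑ 1/i²
times R is at most 2. The term i = 0 vanishes, as division by zero gives 0. -/
lemma sum_min_div_sq_le {R : ℝ} (hR : 1 ≤ R) (N : ℕ) :
    ∑ i ∈ Finset.range N, min R i / (i : ℝ) ^ 2 ≤ 3 + Real.log R := by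
  have hfl : 1 ≤ ⌊R⌋₊ := Nat.le_floor (by simpa using hR)
  have hsub : Finset.range N ⊆ insert 0 (Finset.Icc 1 ⌊R⌋₊ ∪ Finset.Ioo ⌊R⌋₊ N) := by
    intro i hi
    simp only [Finset.mem_range, Finset.mem_insert, Finset.mem_union, Finset.mem_Icc,
      Finset.mem_Ioo] at *
    omega
  have hnn : ∀ i : ℕ, 0 ≤ min R i / (i : ℝ) ^ 2 := fun i => by positivity
  have hA : ∑ i ∈ Finset.Icc 1 ⌊R⌋₊, min R i / (i : ℝ) ^ 2 ≤ 1 + Real.log R := by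
    have h1 : ∑ i ∈ Finset.Icc 1 ⌊R⌋₊, min R i / (i : ℝ) ^ 2 ≤ (harmonic ⌊R⌋₊ : ℝ) := by
      rw [harmonic_eq_sum_Icc]
      push_cast
      refine Finset.sum_le_sum fun i hi => ?_
      have hi0 : (0 : ℝ) < i := by exact_mod_cast (Finset.mem_Icc.1 hi).1
      rw [div_le_iff₀ (by positivity)]
      calc min R i ≤ i := min_le_right _ _
        _ = (i : ℝ)⁻¹ * i ^ 2 := by field_simp
    refine h1.trans ((harmonic_le_one_add_log _).trans ?_)
    gcongr
    exact Nat.floor_le (by linarith)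
  have hB : ∑ i ∈ Finset.Ioo ⌊R⌋₊ N, min R i / (i : ℝ) ^ 2 ≤ 2 := by
    have h1 : ∑ i ∈ Finset.Ioo ⌊R⌋₊ N, min R i / (i : ℝ) ^ 2
        ≤ R * ∑ i ∈ Finset.Ioo ⌊R⌋₊ N, ((i : ℝ) ^ 2)⁻¹ := by
      rw [Finset.mul_sum]
      refine Finset.sum_le_sum fun i _ => ?_
      rw [div_eq_mul_inv]
      gcongr
      exact min_le_left _ _
    refine h1.trans ?_
    have h2 := sum_Ioo_inv_sq_le (α := ℝ) ⌊R⌋₊ N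
    have h3 := Nat.lt_floor_add_one R
    calc R * ∑ i ∈ Finset.Ioo ⌊R⌋₊ N, ((i : ℝ) ^ 2)⁻¹
        ≤ R * (2 / (⌊R⌋₊ + 1)) := by gcongr
      _ ≤ 2 := by
        rw [mul_div_assoc', div_le_iff₀ (by positivity)]
        linarith
  calc ∑ i ∈ Finset.range N, min R i / (i : ℝ) ^ 2
      ≤ ∑ i ∈ insert 0 (Finset.Icc 1 ⌊R⌋₊ ∪ Finset.Ioo ⌊R⌋₊ N), min R i / (i : ℝ) ^ 2 :=
        Finset.sum_le_sum_of_subset_of_nonneg hsub fun i _ _ => hnn i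
    _ ≤ ∑ i ∈ Finset.Icc 1 ⌊R⌋₊ ∪ Finset.Ioo ⌊R⌋₊ N, min R i / (i : ℝ) ^ 2 := by
        rw [Finset.sum_insert (by simp)]
        simp
    _ ≤ _ := by
        rw [Finset.sum_union (Finset.disjoint_left.2 fun i h1 h2 => by
          simp only [Finset.mem_Icc, Finset.mem_Ioo] at h1 h2; omega)]
        linarith

lemma log_max_one {x : ℝ} (hx : 0 ≤ x) : Real.log (max 1 x) = Real.posLog x := by
  rcases le_or_gt 1 x with h | h
  · rw [max_eq_right h]
    exact (max_eq_right (Real.log_nonneg h)).symm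
  · rw [max_eq_left h.le, Real.log_one]
    exact (max_eq_left (Real.log_nonpos hx h.le)).symm

/-- With R = max(1, n/p) one has min(n, |h|p) ≤ p min(R, |h|), and the weights are at most 1/h². The
two half-lines each contribute p(3 + log R), hence the 6. -/
lemma integral_min_coeffMeasure_le {W n p : ℝ} (hW : 0 < W) (hW1 : W ≤ 1) (hn : 0 ≤ n)
    (hp : 0 < p) :
    ∫ h : ℤ, min n (|(h : ℝ)| * p) ∂coeffMeasure W ≤ 6 * p * (1 + Real.posLog (n / p)) := by
  have := isFiniteMeasure_coeffMeasure hW hW1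
  set R := max 1 (n / p)
  have hR : 1 ≤ R := le_max_left _ _
  have hlog : Real.log R = Real.posLog (n / p) :=
    log_max_one (by positivity)
  have hint : Integrable (fun h : ℤ => min n (|(h : ℝ)| * p)) (coeffMeasure W) := by
    refine Integrable.of_bound (C := n) (by fun_prop) (.of_forall fun h => ?_)
    rw [Real.norm_of_nonneg (by positivity)]
    exact min_le_left _ _
  rw [integral_countable hint]
  let g : ℕ → ℝ := fun i => min R i / (i : ℝ) ^ 2
  have hg0 : ∀ i, 0 ≤ g i := fun i => by positivity
  have hgs : Summable g := summable_of_sum_range_le hg0 (sum_min_div_sq_le hR)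
  have hgt : ∑' i, g i ≤ 3 + Real.log R :=
    Real.tsum_le_of_sum_range_le hg0 (sum_min_div_sq_le hR)
  have hG : HasSum (fun h : ℤ => g h.natAbs) (∑' i, g i + ∑' i, g i - g (0 : ℤ).natAbs) := by
    have h1 : HasSum (fun n : ℕ => g (n : ℤ).natAbs) (∑' i, g i) := by
      simpa only [Int.natAbs_natCast] using hgs.hasSum
    have h2 : HasSum (fun n : ℕ => g (-(n : ℤ)).natAbs) (∑' i, g i) := by
      simpa only [Int.natAbs_neg, Int.natAbs_natCast] using hgs.hasSum
    exact HasSum.of_nat_of_neg (f := fun h : ℤ => g h.natAbs) h1 h2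
  have hle : ∀ h : ℤ, (coeffMeasure W).real {h} • min n (|(h : ℝ)| * p) ≤ p * g h.natAbs := by
    intro h
    rw [measureReal_def, coeffMeasure_singleton, ENNReal.toReal_ofReal (by positivity),
      smul_eq_mul]
    rcases eq_or_ne h 0 with rfl | hh
    · simp [g, hn]
    · have habs : ((h.natAbs : ℕ) : ℝ) = |(h : ℝ)| := by
        rw [Nat.cast_natAbs]; push_cast; rfl
      have h1 : min n (|(h : ℝ)| * p) ≤ p * min R |(h : ℝ)| := by
        rw [mul_min_of_nonneg _ _ hp.le]
        refine min_le_min ?_ (by rw [mul_comm])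
        calc n = p * (n / p) := by field_simp
          _ ≤ p * R := by gcongr; exact le_max_right _ _
      calc ‖intervalCoeff W h‖ ^ 2 * min n (|(h : ℝ)| * p)
          ≤ 1 / (h : ℝ) ^ 2 * (p * min R |(h : ℝ)|) :=
            mul_le_mul (norm_intervalCoeff_sq_le hW.le hh) h1 (by positivity) (by positivity)
        _ = p * g h.natAbs := by
            simp only [g, habs, sq_abs]
            ring
  have hsum : Summable fun h : ℤ => (coeffMeasure W).real {h} • min n (|(h : ℝ)| * p) :=
    Summable.of_nonneg_of_le (fun h => by positivity) hle (hG.summable.mul_left p)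
  refine (hsum.tsum_le_tsum hle (hG.summable.mul_left p)).trans ?_
  rw [tsum_mul_left, hG.tsum_eq, ← hlog]
  have hg00 : g (0 : ℤ).natAbs = 0 := by simp [g]
  have hl := Real.log_nonneg hR
  rw [hg00]
  nlinarith

/-! ### Translations of the domain and its perimeter -/

/-- The number of points that leave `Ω` under translation by `-h`. -/
def translationDefect (Ω : Finset (Fin d → ℤ)) (h : Fin d → ℤ) : ℕ :=
  (Ω.filter fun q => q - h ∉ Ω).card

lemma translationDefect_zero (Ω : Finset (Fin d → ℤ)) : translationDefect Ω 0 = 0 := by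
  simp [translationDefect]

lemma translationDefect_le_card (Ω : Finset (Fin d → ℤ)) (h : Fin d → ℤ) :
    translationDefect Ω h ≤ Ω.card :=
  Finset.card_filter_le _ _

/-- If q - h - h' is outside Ω, then either q - h is already outside, or q - h is a point of Ω that
the second shift expels. -/
lemma translationDefect_add_le (Ω : Finset (Fin d → ℤ)) (h h' : Fin d → ℤ) :
    translationDefect Ω (h + h') ≤ translationDefect Ω h + translationDefect Ω h' := by
  classical
  have hsub : (Ω.filter fun q => q - (h + h') ∉ Ω) ⊆ (Ω.filter fun q => q - h ∉ Ω) ∪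
      (Ω.filter fun q => q - h' ∉ Ω).image (· + h) := by
    intro q hq
    rw [Finset.mem_filter] at hq
    rw [Finset.mem_union, Finset.mem_filter, Finset.mem_image]
    by_cases hqh : q - h ∈ Ω
    · exact Or.inr ⟨q - h, Finset.mem_filter.2 ⟨hqh, by rw [sub_sub]; exact hq.2⟩, by simp⟩
    · exact Or.inl ⟨hq.1, hqh⟩
  refine (Finset.card_le_card hsub).trans ((Finset.card_union_le _ _).trans ?_)
  exact Nat.add_le_add_left Finset.card_image_le _

/-- Translation is a bijection between the points of Ω that stay under h and those that stay under
-h. -/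
lemma translationDefect_neg (Ω : Finset (Fin d → ℤ)) (h : Fin d → ℤ) :
    translationDefect Ω (-h) = translationDefect Ω h := by
  have h1 := Finset.card_filter_add_card_filter_not (s := Ω) (fun q => q - h ∈ Ω)
  have h2 := Finset.card_filter_add_card_filter_not (s := Ω) (fun q => q - -h ∈ Ω)
  have h3 : (Ω.filter fun q => q - h ∈ Ω).card = (Ω.filter fun q => q - -h ∈ Ω).card := by
    refine Finset.card_bij' (fun q _ => q - h) (fun q _ => q + h) ?_ ?_ ?_ ?_ <;>
    simp +contextual
  unfold translationDefect
  omega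

lemma translationDefect_zsmul_le (Ω : Finset (Fin d → ℤ)) (c : ℤ) (h : Fin d → ℤ) :
    translationDefect Ω (c • h) ≤ c.natAbs * translationDefect Ω h := by
  have hn : ∀ n : ℕ, translationDefect Ω (n • h) ≤ n * translationDefect Ω h := by
    intro n
    induction n with
    | zero => simp [translationDefect_zero]
    | succ n ih =>
      rw [succ_nsmul, add_mul, one_mul]
      exact (translationDefect_add_le Ω _ _).trans (Nat.add_le_add_right ih _)
  obtain ⟨n, rfl | rfl⟩ := c.eq_nat_or_neg
  · simpa using hn n
  · rw [neg_smul, translationDefect_neg]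
    simpa using hn n

lemma summable_boundary (Ω : Finset (Fin d → ℤ)) :
    Summable fun q : Fin d → ℤ => ∑ j : Fin d,
      |Set.indicator (↑Ω : Set (Fin d → ℤ)) (fun _ => (1 : ℝ)) (q + Pi.single j 1)
        - Set.indicator (↑Ω : Set (Fin d → ℤ)) (fun _ => (1 : ℝ)) q| := by
  classical
  refine summable_sum fun j _ => ?_
  refine summable_of_ne_finset_zero (s := Ω ∪ Ω.image (· - Pi.single j 1)) fun q hq => ?_
  rw [Finset.mem_union, not_or, Finset.mem_image] at hq
  have h2 : q + Pi.single j 1 ∉ Ω := fun hc => hq.2 ⟨_, hc, by simp⟩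
  simp [hq.1, h2]

/-- A point q of Ω with q - e_j outside produces a jump of the indicator across the edge that starts
at q - e_j, and distinct q give distinct edges. -/
lemma translationDefect_single_le (Ω : Finset (Fin d → ℤ)) (j : Fin d) :
    (translationDefect Ω (Pi.single j 1) : ℝ) ≤ digitalPerimeter Ω := by
  classical
  rw [digitalPerimeter]
  set s := (Ω.filter fun q => q - Pi.single j 1 ∉ Ω).image (· - Pi.single j (1 : ℤ))
  have hs : s.card = translationDefect Ω (Pi.single j 1) :=
    Finset.card_image_of_injective _ (sub_left_injective)
  rw [← hs, ← nsmul_one, ← Finset.sum_const]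
  refine le_trans (Finset.sum_le_sum fun q hq => ?_)
    ((summable_boundary Ω).sum_le_tsum s fun q _ => by positivity)
  obtain ⟨p, hp, rfl⟩ := Finset.mem_image.1 hq
  rw [Finset.mem_filter] at hp
  refine le_trans ?_ (Finset.single_le_sum (f := fun j : Fin d =>
    |Set.indicator (↑Ω : Set (Fin d → ℤ)) (fun _ => (1 : ℝ)) (p - Pi.single _ 1 + Pi.single j 1)
      - Set.indicator (↑Ω : Set (Fin d → ℤ)) (fun _ => (1 : ℝ)) (p - Pi.single _ 1)|)
    (fun i _ => abs_nonneg _) (Finset.mem_univ j))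
  simp [hp.1, hp.2]

/-- A point of Ω with least first coordinate leaves under a unit shift. This allows division by the
perimeter later. -/
lemma one_le_digitalPerimeter (hd : 1 ≤ d) {Ω : Finset (Fin d → ℤ)} (hΩ : Ω.Nonempty) :
    1 ≤ digitalPerimeter Ω := by
  let j : Fin d := ⟨0, hd⟩
  obtain ⟨q, hq, hmin⟩ := Ω.exists_min_image (fun q => q j) hΩ
  refine le_trans ?_ (translationDefect_single_le Ω j)
  have : 0 < translationDefect Ω (Pi.single j 1) := by
    refine Finset.card_pos.2 ⟨q, Finset.mem_filter.2 ⟨hq, fun hc => ?_⟩⟩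
    have := hmin _ hc
    simp at this
  exact_mod_cast this

/-- The shift h is performed axis by axis in unit moves, each costing at most one perimeter. The cap
at n_Ω is kept because it truncates the divergent sum of 1/|h_j|. -/
lemma translationDefect_le (Ω : Finset (Fin d → ℤ)) (h : Fin d → ℤ) :
    (translationDefect Ω h : ℝ)
      ≤ ∑ j, min (Ω.card : ℝ) (|(h j : ℝ)| * digitalPerimeter Ω) := by
  have h1 : translationDefect Ω h ≤ ∑ j, translationDefect Ω (h j • Pi.single j (1 : ℤ)) := by
    have hh : h = ∑ j, h j • (Pi.single j 1 : Fin d → ℤ) := by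
      simpa using (pi_eq_sum_univ' h)
    conv_lhs => rw [hh]
    exact Finset.le_sum_of_subadditive _ (translationDefect_zero Ω).le
      (translationDefect_add_le Ω) _ _
  refine (Nat.cast_le.2 h1).trans ?_
  push_cast
  refine Finset.sum_le_sum fun j _ => le_min ?_ ?_
  · exact_mod_cast translationDefect_le_card Ω _
  · refine (Nat.cast_le.2 (translationDefect_zsmul_le Ω (h j) (Pi.single j 1))).trans ?_
    push_cast
    rw [Nat.cast_natAbs]
    push_cast
    gcongr
    exact translationDefect_single_le Ω j

/-- The spectral leakage of the time-frequency limiting operator is controlled by the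
perimeter of the domain. -/
lemma sum_sub_norm_cubeCoeff_le {W : ℝ} (hW : 0 < W) (hW1 : W ≤ 1) (hd : 1 ≤ d)
    {Ω : Finset (Fin d → ℤ)} (hΩ : Ω.Nonempty) :
    ∑ q ∈ Ω, (W ^ d - ∑ q' ∈ Ω, ‖cubeCoeff W (q - q')‖ ^ 2)
      ≤ 6 * d * W ^ (d - 1) * (digitalPerimeter Ω *
          (1 + Real.posLog (Ω.card / digitalPerimeter Ω))) := by
  classical
  have := isFiniteMeasure_coeffMeasure hW hW1
  have hp : 0 < digitalPerimeter Ω := zero_lt_one.trans_le (one_le_digitalPerimeter hd hΩ)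
  set μ : Measure (Fin d → ℤ) := Measure.pi fun _ => coeffMeasure W
  have hsing : ∀ h : Fin d → ℤ, μ.real {h} = ‖cubeCoeff W h‖ ^ 2 := by
    intro h
    rw [measureReal_def, Measure.pi_singleton, cubeCoeff_eq_prod, norm_prod, ← Finset.prod_pow,
      ENNReal.toReal_prod]
    exact Finset.prod_congr rfl fun j _ => by
      rw [coeffMeasure_singleton, ENNReal.toReal_ofReal (by positivity)]
  have huniv : μ.real Set.univ = W ^ d := by
    rw [measureReal_def, Measure.pi_univ, ENNReal.toReal_prod]
    simp [coeffMeasure_univ hW hW1, hW.le]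
  -- By Parseval W^d is the total mass of μ, so the difference is the mass of the shifts that take q
  -- out of Ω.
  have h1 : ∀ q, W ^ d - ∑ q' ∈ Ω, ‖cubeCoeff W (q - q')‖ ^ 2
      = ∫ h, (if q - h ∉ Ω then 1 else 0 : ℝ) ∂μ := by
    intro q
    have hms : MeasurableSet {h : Fin d → ℤ | q - h ∈ Ω} := .of_discrete
    have hset : {h : Fin d → ℤ | q - h ∈ Ω} = ↑(Ω.image (q - ·)) := by
      ext h
      simp only [Set.mem_ofPred_eq, Finset.coe_image, Set.mem_image, Finset.mem_coe]
      exact ⟨fun hh => ⟨_, hh, by simp⟩, by rintro ⟨p, hp, rfl⟩; simpa using hp⟩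
    have h2 : μ.real {h | q - h ∈ Ω} = ∑ q' ∈ Ω, ‖cubeCoeff W (q - q')‖ ^ 2 := by
      rw [hset, ← sum_measureReal_singleton, Finset.sum_image (by simp)]
      exact Finset.sum_congr rfl fun q' _ => hsing _
    have h3 : ∀ h, (if q - h ∉ Ω then 1 else 0 : ℝ)
        = Set.indicator {h | q - h ∈ Ω}ᶜ (fun _ => 1) h := by
      intro h
      by_cases hh : q - h ∈ Ω <;> simp [hh]
    simp only [h3]
    rw [integral_indicator_const _ hms.compl, smul_eq_mul, mul_one, measureReal_compl hms, huniv, h2]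
  have hbint : ∀ (f : (Fin d → ℤ) → ℝ) (C : ℝ), (∀ h, |f h| ≤ C) → Integrable f μ :=
    fun f C hf => Integrable.of_bound (C := C) (by fun_prop) (.of_forall hf)
  simp only [h1]
  rw [← integral_finsetSum _ fun q _ => hbint _ 1 fun h => by split_ifs <;> simp]
  have h4 : ∀ h, ∑ q ∈ Ω, (if q - h ∉ Ω then 1 else 0 : ℝ) = translationDefect Ω h := by
    intro h
    rw [translationDefect, Finset.card_filter]
    push_cast
    rfl
  simp only [h4]
  have hmin : ∀ x : ℤ, |min (Ω.card : ℝ) (|(x : ℝ)| * digitalPerimeter Ω)| ≤ Ω.card := by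
    intro x
    rw [abs_of_nonneg (by positivity)]
    exact min_le_left _ _
  have hI : ∀ j : Fin d, Integrable
      (fun h : Fin d → ℤ => min (Ω.card : ℝ) (|(h j : ℝ)| * digitalPerimeter Ω)) μ :=
    fun j => hbint _ Ω.card fun h => hmin (h j)
  have h5 : ∫ h, (translationDefect Ω h : ℝ) ∂μ
      ≤ ∑ j, ∫ h, min (Ω.card : ℝ) (|(h j : ℝ)| * digitalPerimeter Ω) ∂μ := by
    rw [← integral_finsetSum _ fun j _ => hI j]
    refine integral_mono (hbint _ Ω.card fun h => ?_) (integrable_finsetSum _ fun j _ => hI j)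
      (translationDefect_le Ω)
    rw [abs_of_nonneg (by positivity)]
    exact_mod_cast translationDefect_le_card Ω h
  -- The integrand depends on h_j alone; each of the other d - 1 factors of the product measure
  -- contributes its mass W.
  have h6 : ∀ j : Fin d, ∫ h, min (Ω.card : ℝ) (|(h j : ℝ)| * digitalPerimeter Ω) ∂μ
      ≤ W ^ (d - 1) * (6 * digitalPerimeter Ω *
          (1 + Real.posLog (Ω.card / digitalPerimeter Ω))) := by
    intro j
    have hmap := integral_map (μ := μ) (φ := Function.eval j)
      (f := fun x : ℤ => min (Ω.card : ℝ) (|(x : ℝ)| * digitalPerimeter Ω))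
      (measurable_pi_apply j).aemeasurable (by fun_prop)
    simp only [Function.eval] at hmap
    rw [← hmap]
    have hmu : μ.map (fun f : Fin d → ℤ => f j)
        = (∏ i ∈ Finset.univ.erase j, coeffMeasure W Set.univ) • coeffMeasure W :=
      Measure.pi_map_eval (μ := fun _ : Fin d => coeffMeasure W) j
    rw [hmu, integral_smul_measure, coeffMeasure_univ hW hW1, Finset.prod_const,
      Finset.card_erase_of_mem (Finset.mem_univ j), Finset.card_univ, Fintype.card_fin,
      ENNReal.toReal_pow, ENNReal.toReal_ofReal hW.le, smul_eq_mul]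
    gcongr
    exact integral_min_coeffMeasure_le hW hW1 (by positivity) hp
  refine h5.trans ((Finset.sum_le_sum fun j _ => h6 j).trans (le_of_eq ?_))
  simp
  ring

/-! ### Variational bounds for positive operators -/

section Spectral

variable {H : Type*} [NormedAddCommGroup H] [InnerProductSpace ℂ H]

/-- A positive operator bounded by `M` along the image of `u` satisfies
`‖T u‖² ≤ M ⟨u, T u⟩`. -/
lemma norm_sq_apply_le_of_positive {T : H →ₗ[ℂ] H} (hT : T.IsSymmetric)
    (hpos : ∀ v, 0 ≤ (inner ℂ v (T v)).re) {M : ℝ} (hM : 0 ≤ M) (u : H)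
    (hu : (inner ℂ (T u) (T (T u))).re ≤ M * ‖T u‖ ^ 2) :
    ‖T u‖ ^ 2 ≤ M * (inner ℂ u (T u)).re := by
  have hself : (inner ℂ (T u) (T u)).re = ‖T u‖ ^ 2 := inner_self_eq_norm_sq (𝕜 := ℂ) (T u)
  -- Positivity of T is tested at u - t T u; the best choice is t = 1/M.
  have key : ∀ t : ℝ, (2 * t - t ^ 2 * M) * ‖T u‖ ^ 2 ≤ (inner ℂ u (T u)).re := by
    intro t
    have h := hpos (u - (t : ℂ) • T u)
    have h1 : inner ℂ u (T (T u)) = inner ℂ (T u) (T u) := (hT u (T u)).symm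
    simp only [map_sub, map_smul, inner_sub_left, inner_sub_right, inner_smul_left,
      inner_smul_right, Complex.conj_ofReal, h1, Complex.sub_re, Complex.re_ofReal_mul,
      hself] at h
    nlinarith [sq_nonneg t]
  -- For M = 0 the inequality 2t‖T u‖² ≤ ⟨u, T u⟩ holds for every t, which a large t contradicts
  -- unless T u = 0.
  rcases hM.eq_or_lt with rfl | hM
  · by_contra hcon
    have hpos' : 0 < ‖T u‖ ^ 2 := by linarith
    have := key ((((inner ℂ u (T u)).re) + 1) / (2 * ‖T u‖ ^ 2))
    have h0 : ((inner ℂ u (T u)).re + 1) / (2 * ‖T u‖ ^ 2) * (2 * ‖T u‖ ^ 2)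
        = (inner ℂ u (T u)).re + 1 := div_mul_cancel₀ _ (by positivity)
    nlinarith
  · have := key M⁻¹
    have h2 : (2 * M⁻¹ - M⁻¹ ^ 2 * M) = M⁻¹ := by field_simp; ring
    rw [h2, inv_mul_le_iff₀ hM] at this
    exact this

/-- First-order optimality: a maximizer of the Rayleigh quotient of `T` is decoupled by `T` from
every orthogonal competitor. -/
lemma inner_apply_eq_zero_of_rayleigh_max {T : H →ₗ[ℂ] H} (hT : T.IsSymmetric) {u v : H}
    (huv : inner ℂ u v = 0)
    (hmax : ∀ c : ℂ, (inner ℂ (u + c • v) (T (u + c • v))).re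
      ≤ (inner ℂ u (T u)).re * ‖u + c • v‖ ^ 2) (hu : ‖u‖ = 1) :
    inner ℂ v (T u) = 0 := by
  have hsym : inner ℂ u (T v) = starRingEnd ℂ (inner ℂ v (T u)) := by
    rw [← hT u v, inner_conj_symm]
  set z := inner ℂ v (T u)
  have hn : ∀ c : ℂ, ‖u + c • v‖ ^ 2 = 1 + Complex.normSq c * ‖v‖ ^ 2 := by
    intro c
    rw [norm_add_sq (𝕜 := ℂ), inner_smul_right, huv, norm_smul, hu, mul_pow,
      ← Complex.normSq_eq_norm_sq]
    simp
  -- Perturbing u by t z v with z = ⟨v, T u⟩ gains 2t|z|² at first order, while the loss is only of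
  -- order t². A small t then forces z = 0.
  have hexp : ∀ t : ℝ, t * (2 * Complex.normSq z)
      ≤ t ^ 2 * (Complex.normSq z * ((inner ℂ u (T u)).re * ‖v‖ ^ 2 - (inner ℂ v (T v)).re)) := by
    intro t
    have h := hmax (t * z)
    rw [hn] at h
    simp only [map_add, map_smul, inner_add_left, inner_add_right, inner_smul_left,
      inner_smul_right, hsym, Complex.add_re] at h
    have e1 : ((starRingEnd ℂ) (t * z) * z).re = t * Complex.normSq z := by
      simp [Complex.normSq_apply]; ring
    have e2 : (t * z * (starRingEnd ℂ) z).re = t * Complex.normSq z := by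
      simp [Complex.normSq_apply]; ring
    have e3 : (t * z * ((starRingEnd ℂ) (t * z) * inner ℂ v (T v))).re
        = t ^ 2 * Complex.normSq z * (inner ℂ v (T v)).re := by
      simp [Complex.normSq_apply]; ring
    have e4 : Complex.normSq (t * z) = t ^ 2 * Complex.normSq z := by
      rw [Complex.normSq_mul, Complex.normSq_ofReal]; ring
    rw [e4] at h
    rw [mul_add (t * z), Complex.add_re, e2, e3] at h
    change _ + ((starRingEnd ℂ) (t * z) * z).re + _ ≤ _ at h
    rw [e1] at h
    nlinarith
  by_contra hz
  have hzp : 0 < Complex.normSq z := Complex.normSq_pos.2 hz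
  set B := (inner ℂ u (T u)).re * ‖v‖ ^ 2 - (inner ℂ v (T v)).re
  have hdiv : ∀ t : ℝ, 2 * t ≤ t ^ 2 * B := by
    intro t
    have := hexp t
    by_contra hcon
    nlinarith [mul_pos hzp (sub_pos.2 (not_le.1 hcon))]
  have h1 := hdiv (1 / (|B| + 1))
  have hB : 0 < |B| + 1 := by positivity
  have h2 : (1 / (|B| + 1)) ^ 2 * B ≤ 1 / (|B| + 1) := by
    rw [div_pow, one_pow, div_mul_eq_mul_div, one_mul, div_le_div_iff₀ (by positivity) hB]
    nlinarith [le_abs_self B, abs_nonneg B]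
  have h3 : 0 < 1 / (|B| + 1) := by positivity
  linarith

variable [FiniteDimensional ℂ H]

/-- Sequential maximizers `u_1, …, u_K` of the Rayleigh quotient of an operator `0 ≤ T ≤ 1` with
`K - 1 ≤ tr T ≤ K` have total spectral deficiency at most `1 + tr (T - T²)`. -/
lemma sum_one_sub_rayleigh_le {T : H →ₗ[ℂ] H} (hT : T.IsSymmetric)
    (hpos : ∀ v, 0 ≤ (inner ℂ v (T v)).re) (hle : ∀ v, (inner ℂ v (T v)).re ≤ ‖v‖ ^ 2)
    {K : ℕ} (hK : 1 ≤ K) {u : Fin K → H} (hu : Orthonormal ℂ u)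
    (hmax : ∀ k f, (∀ l < k, inner ℂ (u l) f = 0) →
      (inner ℂ f (T f)).re ≤ (inner ℂ (u k) (T (u k))).re * ‖f‖ ^ 2)
    (htr1 : (LinearMap.trace ℂ H T).re ≤ K) (htr2 : K ≤ (LinearMap.trace ℂ H T).re + 1) :
    ∑ k, (1 - (inner ℂ (u k) (T (u k))).re)
      ≤ 1 + ((LinearMap.trace ℂ H T).re - (LinearMap.trace ℂ H (T ∘ₗ T)).re) := by
  classical
  set lam : Fin K → ℝ := fun k => (inner ℂ (u k) (T (u k))).re
  have hperp : ∀ k v, (∀ l ≤ k, inner ℂ (u l) v = 0) → inner ℂ v (T (u k)) = 0 := by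
    intro k v hv
    refine inner_apply_eq_zero_of_rayleigh_max hT (hv k le_rfl) (fun c => ?_) (hu.1 k)
    refine hmax k _ fun l hl => ?_
    rw [inner_add_right, inner_smul_right, hv l hl.le, hu.2 hl.ne]
    simp
  have hoff : ∀ k l, k ≠ l → inner ℂ (u l) (T (u k)) = 0 := by
    have h1 : ∀ k l, k < l → inner ℂ (u l) (T (u k)) = 0 := fun k l hkl =>
      hperp k (u l) fun i hi => hu.2 (hi.trans_lt hkl).ne
    intro k l hkl
    rcases lt_or_gt_of_ne hkl with h | h
    · exact h1 k l h
    · rw [← hT, ← inner_conj_symm, h1 l k h, map_zero]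
  have hcard : K ≤ Module.finrank ℂ H := by
    simpa using hu.linearIndependent.fintype_card_le_finrank
  set N := Module.finrank ℂ H - K
  obtain ⟨b, hb⟩ := Orthonormal.exists_orthonormalBasis_extension_of_card_eq (𝕜 := ℂ) (E := H)
    (ι := Fin K ⊕ Fin N) (by simp [N]; omega) (v := Sum.elim u 0) (s := Set.range Sum.inl) (by
      constructor
      · rintro ⟨_, k, rfl⟩
        exact hu.1 k
      · rintro ⟨_, k, rfl⟩ ⟨_, l, rfl⟩ hkl
        exact hu.2 fun h => hkl (by simp [h]))
  have hbu : ∀ k, b (Sum.inl k) = u k := fun k => hb _ ⟨k, rfl⟩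
  have hbperp : ∀ i l, inner ℂ (u l) (b (Sum.inr i)) = 0 := by
    intro i l
    rw [← hbu]
    exact b.orthonormal.2 (by simp)
  -- The last Rayleigh value L is the threshold: the tapers have values at least L, and the
  -- orthogonal complement has values at most L.
  set last : Fin K := ⟨K - 1, by omega⟩
  have hlast : ∀ k : Fin K, k ≤ last := fun k => Fin.mk_le_mk.2 (by omega)
  set L := lam last
  have hL0 : 0 ≤ L := hpos _
  have hL1 : L ≤ 1 := by simpa [hu.1] using hle (u last)
  have hlamL : ∀ k, L ≤ lam k := by
    intro k
    have := hmax k (u last) fun l hl => hu.2 (hl.trans_le (hlast k)).ne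
    simpa [hu.1] using this
  have hlam1 : ∀ k, lam k ≤ 1 := fun k => by simpa [hu.1] using hle (u k)
  have hnorm1 : ∀ k, ‖T (u k)‖ ^ 2 = lam k ^ 2 := by
    intro k
    have him : inner ℂ (u k) (T (u k)) = (lam k : ℂ) := by
      exact (hT.coe_re_inner_self_apply (u k)).symm
    rw [← b.sum_sq_norm_inner_right, Fintype.sum_sum_type, Finset.sum_eq_single k]
    · rw [hbu, him]
      have hz : ∀ i ∈ Finset.univ, ‖inner ℂ (b (Sum.inr i)) (T (u k))‖ ^ 2 = 0 := by
        intro i _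
        rw [hperp k _ fun l _ => hbperp i l]
        simp
      rw [Finset.sum_eq_zero hz]
      simp
    · intro l _ hl
      rw [hbu, hoff k l hl.symm]
      simp
    · simp
  set al : Fin N → ℝ := fun i => (inner ℂ (b (Sum.inr i)) (T (b (Sum.inr i)))).re
  -- The vector T b is again orthogonal to all tapers, so the maximality of the last one bounds its
  -- Rayleigh quotient by L.
  have hnorm2 : ∀ i, ‖T (b (Sum.inr i))‖ ^ 2 ≤ L * al i := by
    intro i
    refine norm_sq_apply_le_of_positive hT hpos hL0 _ (hmax last _ fun l _ => ?_)
    rw [← hT, ← inner_conj_symm, hperp l _ fun j _ => hbperp i j, map_zero]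
  have htrace : (LinearMap.trace ℂ H T).re = ∑ k, lam k + ∑ i, al i := by
    rw [LinearMap.trace_eq_sum_inner T b, Fintype.sum_sum_type]
    simp only [hbu, Complex.add_re, Complex.re_sum]
    rfl
  have htrace2 : (LinearMap.trace ℂ H (T ∘ₗ T)).re
      = ∑ k, lam k ^ 2 + ∑ i, ‖T (b (Sum.inr i))‖ ^ 2 := by
    have hTT : ∀ v, inner ℂ v ((T ∘ₗ T) v) = ((‖T v‖ ^ 2 : ℝ) : ℂ) := by
      intro v
      rw [LinearMap.comp_apply, ← hT, inner_self_eq_norm_sq_to_K]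
      simp
    rw [LinearMap.trace_eq_sum_inner (T ∘ₗ T) b, Fintype.sum_sum_type]
    simp only [hTT, hbu, hnorm1, Complex.add_re, Complex.re_sum, Complex.ofReal_re]
  have h1 : L * ∑ k, (1 - lam k) ≤ ∑ k, (lam k - lam k ^ 2) := by
    rw [Finset.mul_sum]
    refine Finset.sum_le_sum fun k _ => ?_
    nlinarith [hlamL k, hlam1 k]
  have h2 : ∑ i, ‖T (b (Sum.inr i))‖ ^ 2 ≤ L * ∑ i, al i := by
    rw [Finset.mul_sum]
    exact Finset.sum_le_sum fun i _ => hnorm2 i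
  have h3 : 0 ≤ ∑ i, al i := Finset.sum_nonneg fun i _ => hpos _
  have h4 : ∑ k, (1 - lam k) = K - ∑ k, lam k := by
    rw [Finset.sum_sub_distrib]
    simp
  rw [h4, Finset.sum_sub_distrib] at h1
  change ∑ k, (1 - lam k) ≤ _
  rw [h4]
  rw [htrace] at htr1 htr2 ⊢
  rw [htrace2]
  -- The two estimates give tr (T - T²) ≥ L(K - ∑ λ) + (1 - L)(tr T - ∑ λ) = tr T - ∑ λ + L(K - tr
  -- T). The last term is nonnegative and tr T ≥ K - 1, so no division by L or 1 - L occurs.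
  nlinarith [mul_nonneg hL0 (sub_nonneg.2 htr1)]

end Spectral

/-! ### Toeplitz operators and trigonometric polynomials -/

variable {Ω : Finset (Fin d → ℤ)}

/-- The trigonometric polynomial with coefficients `f` on `Ω`. -/
noncomputable def trigPoly (f : EuclideanSpace ℂ Ω) (ξ : Fin d → ℝ) : ℂ :=
  ∑ q : Ω, f q * expo q.1 ξ

/-- The Toeplitz operator on `Ω` with coefficients `t`. -/
noncomputable def toeplitz (Ω : Finset (Fin d → ℤ)) (t : (Fin d → ℤ) → ℂ) :
    EuclideanSpace ℂ Ω →ₗ[ℂ] EuclideanSpace ℂ Ω where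
  toFun f := WithLp.toLp 2 fun q => ∑ q' : Ω, t (q'.1 - q.1) * f q'
  map_add' f g := by
    ext q
    simp [mul_add, Finset.sum_add_distrib]
  map_smul' c f := by
    ext q
    simp only [PiLp.smul_apply, smul_eq_mul, RingHom.id_apply, Finset.mul_sum]
    exact Finset.sum_congr rfl fun _ _ => by ring

lemma toeplitz_apply (t : (Fin d → ℤ) → ℂ) (f : EuclideanSpace ℂ Ω) (q : Ω) :
    toeplitz Ω t f q = ∑ q' : Ω, t (q'.1 - q.1) * f q' := rfl

lemma continuous_trigPoly (f : EuclideanSpace ℂ Ω) : Continuous (trigPoly f) :=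
  continuous_finsetSum _ fun q _ => continuous_const.mul (continuous_expo q.1)

lemma trigPoly_periodic (f : EuclideanSpace ℂ Ω) (ξ : Fin d → ℝ) (k : Fin d → ℤ) :
    trigPoly f (ξ + fun j => (k j : ℝ)) = trigPoly f ξ := by
  simp only [trigPoly, expo_periodic]

lemma trigPoly_smul (c : ℂ) (f : EuclideanSpace ℂ Ω) (ξ : Fin d → ℝ) :
    trigPoly (c • f) ξ = c * trigPoly f ξ := by
  simp only [trigPoly, PiLp.smul_apply, smul_eq_mul, Finset.mul_sum, mul_assoc]

/-- The quadratic form of a Toeplitz operator in terms of its symbol. -/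
lemma inner_toeplitz {w : (Fin d → ℝ) → ℂ} {s : Set (Fin d → ℝ)} (hw : IntegrableOn w s)
    {t : (Fin d → ℤ) → ℂ} (ht : ∀ q, t q = ∫ ξ in s, w ξ * expo q ξ)
    (f g : EuclideanSpace ℂ Ω) :
    inner ℂ g (toeplitz Ω t f)
      = ∫ ξ in s, w ξ * (trigPoly f ξ * starRingEnd ℂ (trigPoly g ξ)) := by
  have hint : ∀ q : Fin d → ℤ, IntegrableOn (fun ξ => w ξ * expo q ξ) s := fun q =>
    hw.mul_bdd (c := 1) (continuous_expo q).aestronglyMeasurable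
      (.of_forall fun ξ => (norm_expo q ξ).le)
  have hexp : ∀ ξ, w ξ * (trigPoly f ξ * starRingEnd ℂ (trigPoly g ξ))
      = ∑ q : Ω, ∑ q' : Ω, starRingEnd ℂ (g q) * f q' * (w ξ * expo (q'.1 - q.1) ξ) := by
    intro ξ
    simp only [trigPoly, map_sum, map_mul, expo_sub, Finset.sum_mul_sum]
    rw [Finset.sum_comm, Finset.mul_sum]
    refine Finset.sum_congr rfl fun q _ => ?_
    rw [Finset.mul_sum]
    exact Finset.sum_congr rfl fun q' _ => by ring
  simp only [hexp]
  rw [integral_finsetSum _ fun q _ => integrable_finsetSum _ fun q' _ =>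
    (hint _).const_mul _]
  rw [PiLp.inner_apply]
  refine Finset.sum_congr rfl fun q _ => ?_
  rw [integral_finsetSum _ fun q' _ => (hint _).const_mul _, RCLike.inner_apply, toeplitz_apply,
    Finset.sum_mul]
  refine Finset.sum_congr rfl fun q' _ => ?_
  rw [integral_const_mul, ← ht]
  ring

lemma integrableOn_norm_trigPoly_sq (f : EuclideanSpace ℂ Ω) (W : ℝ) :
    IntegrableOn (fun ξ => ‖trigPoly f ξ‖ ^ 2) (cube d W) :=
  ((continuous_trigPoly f).norm.pow 2).continuousOn.integrableOn_compact (isCompact_cube W)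

/-- This makes spectral concentration a quadratic form, so that Slepian tapers become sequential
maximizers of a Rayleigh quotient. -/
lemma inner_toeplitz_cubeCoeff (W : ℝ) (f : EuclideanSpace ℂ Ω) :
    inner ℂ f (toeplitz Ω (cubeCoeff W) f)
      = ((∫ ξ in cube d W, ‖trigPoly f ξ‖ ^ 2 : ℝ) : ℂ) := by
  have h1 : IntegrableOn (fun _ : Fin d → ℝ => (1 : ℂ)) (cube d W) :=
    continuousOn_const.integrableOn_compact (isCompact_cube W)
  rw [inner_toeplitz h1 (fun q => by simp [cubeCoeff]) f f, ← integral_complex_ofReal]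
  congr 1
  ext ξ
  rw [one_mul, Complex.mul_conj, Complex.normSq_eq_norm_sq]

lemma toeplitz_cubeCoeff_one (f : EuclideanSpace ℂ Ω) :
    toeplitz Ω (cubeCoeff 1) f = f := by
  ext q
  rw [toeplitz_apply, Finset.sum_eq_single q]
  · simp [cubeCoeff_one]
  · intro q' _ hq
    have : q'.1 - q.1 ≠ 0 := sub_ne_zero.2 fun h => hq (Subtype.ext h)
    simp [cubeCoeff_one, this]
  · simp

/-- Parseval's identity for trigonometric polynomials. -/
lemma integral_norm_trigPoly_sq (f : EuclideanSpace ℂ Ω) :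
    ∫ ξ in cube d 1, ‖trigPoly f ξ‖ ^ 2 = ‖f‖ ^ 2 := by
  have h := inner_toeplitz_cubeCoeff 1 f
  rw [toeplitz_cubeCoeff_one, inner_self_eq_norm_sq_to_K] at h
  have h' := congrArg Complex.re h
  simp only [Complex.ofReal_re] at h'
  rw [← h', ← Complex.ofReal_re (‖f‖ ^ 2)]
  simp

lemma cube_subset_cube_one {W : ℝ} (hW : W ≤ 1) : cube d W ⊆ cube d 1 := by
  intro x hx
  rw [mem_cube] at *
  exact fun j => (hx j).trans (by linarith)

lemma isSymmetric_toeplitz_cubeCoeff (W : ℝ) :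
    (toeplitz Ω (cubeCoeff W)).IsSymmetric := by
  rw [LinearMap.isSymmetric_iff_inner_map_self_real]
  intro v
  rw [inner_conj_symm, ← inner_conj_symm (𝕜 := ℂ) _ v, inner_toeplitz_cubeCoeff,
    Complex.conj_ofReal]

lemma trace_toeplitz (t : (Fin d → ℤ) → ℂ) :
    LinearMap.trace ℂ _ (toeplitz Ω t) = Ω.card * t 0 := by
  classical
  rw [LinearMap.trace_eq_sum_inner _ (EuclideanSpace.basisFun Ω ℂ)]
  have : ∀ q : Ω, inner ℂ (EuclideanSpace.basisFun Ω ℂ q)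
      (toeplitz Ω t (EuclideanSpace.basisFun Ω ℂ q)) = t 0 := by
    intro q
    simp [EuclideanSpace.inner_single_left, toeplitz_apply]
  rw [Finset.sum_congr rfl fun q _ => this q]
  simp

/-- For a symmetric operator tr T² is the squared Hilbert–Schmidt norm, the sum of the squared
matrix entries. -/
lemma re_trace_toeplitz_comp {t : (Fin d → ℤ) → ℂ} (ht : (toeplitz Ω t).IsSymmetric) :
    (LinearMap.trace ℂ _ (toeplitz Ω t ∘ₗ toeplitz Ω t)).re
      = ∑ q ∈ Ω, ∑ q' ∈ Ω, ‖t (q - q')‖ ^ 2 := by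
  classical
  rw [LinearMap.trace_eq_sum_inner _ (EuclideanSpace.basisFun Ω ℂ), Complex.re_sum,
    ← Finset.sum_coe_sort Ω]
  refine Finset.sum_congr rfl fun q _ => ?_
  rw [LinearMap.comp_apply, ← ht]
  have := inner_self_eq_norm_sq (𝕜 := ℂ) (toeplitz Ω t (EuclideanSpace.basisFun Ω ℂ q))
  rw [RCLike.re_eq_complex_re] at this
  rw [this, EuclideanSpace.norm_sq_eq, ← Finset.sum_coe_sort Ω]
  refine Finset.sum_congr rfl fun q' _ => ?_
  simp [toeplitz_apply]

/-- The restriction of a sequence to `Ω`. -/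
noncomputable def restrictSeq (Ω : Finset (Fin d → ℤ)) (f : (Fin d → ℤ) → ℂ) :
    EuclideanSpace ℂ Ω :=
  WithLp.toLp 2 fun q => f q.1

lemma trigPoly_restrictSeq (f : (Fin d → ℤ) → ℂ) (ξ : Fin d → ℝ) :
    trigPoly (restrictSeq Ω f) ξ = ∑ q ∈ Ω, f q * expo q ξ := by
  rw [trigPoly, ← Finset.sum_coe_sort Ω]
  rfl

lemma inner_restrictSeq (f g : (Fin d → ℤ) → ℂ) :
    inner ℂ (restrictSeq Ω f) (restrictSeq Ω g) = ∑ q ∈ Ω, g q * starRingEnd ℂ (f q) := by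
  rw [PiLp.inner_apply, ← Finset.sum_coe_sort Ω]
  rfl

lemma norm_restrictSeq_sq (f : (Fin d → ℤ) → ℂ) :
    ‖restrictSeq Ω f‖ ^ 2 = ∑ q ∈ Ω, ‖f q‖ ^ 2 := by
  rw [EuclideanSpace.norm_sq_eq, ← Finset.sum_coe_sort Ω]
  rfl

lemma exists_eq_restrictSeq (f : EuclideanSpace ℂ Ω) :
    ∃ g : (Fin d → ℤ) → ℂ, (∀ q ∉ Ω, g q = 0) ∧ restrictSeq Ω g = f := by
  classical
  refine ⟨fun q => if h : q ∈ Ω then f ⟨q, h⟩ else 0, fun q hq => by simp [hq], ?_⟩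
  ext q
  simp [restrictSeq]

lemma concentration_eq (W : ℝ) (f : (Fin d → ℤ) → ℂ) :
    concentration Ω W f = ∫ ξ in cube d W, ‖trigPoly (restrictSeq Ω f) ξ‖ ^ 2 := by
  simp only [concentration, trigPoly_restrictSeq]

/-! ### Slepian tapers: deficiency and window bound -/

namespace IsSlepianTapers

variable {W : ℝ} {K : ℕ} {m : Fin K → (Fin d → ℤ) → ℂ}

lemma orthonormal_restrictSeq (hm : IsSlepianTapers Ω W m) :
    Orthonormal ℂ fun k => restrictSeq Ω (m k) := by
  rw [orthonormal_iff_ite]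
  intro k l
  rw [inner_restrictSeq, hm.orthonormal]
  simp only [eq_comm]

lemma card_le (hm : IsSlepianTapers Ω W m) : K ≤ Ω.card := by
  simpa using hm.orthonormal_restrictSeq.linearIndependent.fintype_card_le_finrank

/-- From n_Ω W^d ≤ K ≤ n_Ω. It keeps the cube inside one period, as T ≤ 1 and Parseval for the
interval require. -/
lemma bandwidth_le_one (hm : IsSlepianTapers Ω W m) (hd : 1 ≤ d) (hΩ : Ω.Nonempty)
    (hK : (Ω.card : ℝ) * W ^ d ≤ K) : W ≤ 1 := by
  by_contra hW
  have h1 : 1 < W ^ d := one_lt_pow₀ (not_le.1 hW) (by omega)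
  have h2 : (K : ℝ) ≤ Ω.card := by exact_mod_cast hm.card_le
  have h3 : (0 : ℝ) < Ω.card := by exact_mod_cast hΩ.card_pos
  nlinarith

lemma rayleigh_le (hm : IsSlepianTapers Ω W m) (k : Fin K) (f : EuclideanSpace ℂ Ω)
    (hf : ∀ l < k, inner ℂ (restrictSeq Ω (m l)) f = 0) :
    ∫ ξ in cube d W, ‖trigPoly f ξ‖ ^ 2 ≤ concentration Ω W (m k) * ‖f‖ ^ 2 := by
  rcases eq_or_ne f 0 with rfl | hf0
  · simp [trigPoly]
  obtain ⟨g, hg, hgf⟩ := exists_eq_restrictSeq ((‖f‖⁻¹ : ℂ) • f)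
  have hn : ‖f‖ ≠ 0 := norm_ne_zero_iff.2 hf0
  have h := hm.maximal k g hg (by
      rw [← norm_restrictSeq_sq, hgf, norm_smul]
      simp [hn]) fun l hl => by
      rw [← inner_restrictSeq, hgf, inner_smul_right, hf l hl, mul_zero]
  rw [concentration_eq _ g, hgf] at h
  simp only [trigPoly_smul, norm_mul, mul_pow] at h
  rw [integral_const_mul] at h
  have h2 : ‖(‖f‖⁻¹ : ℂ)‖ ^ 2 = (‖f‖ ^ 2)⁻¹ := by simp
  rw [h2, inv_mul_le_iff₀ (by positivity)] at h
  linarith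

/-- The total spectral deficiency of the Slepian tapers. -/
lemma sum_one_sub_concentration_le (hm : IsSlepianTapers Ω W m) (hd : 1 ≤ d)
    (hΩ : Ω.Nonempty) (hK : 1 ≤ K) (hW : 0 < W) (hKW : K = ⌈(Ω.card : ℝ) * W ^ d⌉₊) :
    ∑ k, (1 - concentration Ω W (m k)) ≤ 1 + 6 * d * W ^ (d - 1) * (digitalPerimeter Ω *
          (1 + Real.posLog (Ω.card / digitalPerimeter Ω))) := by
  have hK1 : (Ω.card : ℝ) * W ^ d ≤ K := by rw [hKW]; exact Nat.le_ceil _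
  have hK2 : (K : ℝ) ≤ (Ω.card : ℝ) * W ^ d + 1 := by
    rw [hKW]; exact (Nat.ceil_lt_add_one (by positivity)).le
  have hW1 := hm.bandwidth_le_one hd hΩ hK1
  have hsym := isSymmetric_toeplitz_cubeCoeff (Ω := Ω) W
  have hre : ∀ f : EuclideanSpace ℂ Ω, (inner ℂ f (toeplitz Ω (cubeCoeff W) f)).re
      = ∫ ξ in cube d W, ‖trigPoly f ξ‖ ^ 2 := fun f => by
    rw [inner_toeplitz_cubeCoeff, Complex.ofReal_re]
  have htr : (LinearMap.trace ℂ _ (toeplitz Ω (cubeCoeff W))).re = Ω.card * W ^ d := by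
    rw [trace_toeplitz, cubeCoeff_zero hW.le]
    norm_cast
  have h := sum_one_sub_rayleigh_le hsym (fun v => by rw [hre]; positivity) (fun v => by
      rw [hre, ← integral_norm_trigPoly_sq]
      exact setIntegral_mono_set (integrableOn_norm_trigPoly_sq v 1)
        (.of_forall fun ξ => by positivity) (cube_subset_cube_one hW1).eventuallyLE)
    hK hm.orthonormal_restrictSeq (fun k f hf => by
      rw [hre, hre, ← concentration_eq]
      exact hm.rayleigh_le k f hf) (by rwa [htr]) (by rwa [htr])
  simp only [hre, ← concentration_eq] at h
  refine h.trans ?_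
  rw [htr, re_trace_toeplitz_comp hsym]
  have h2 := sum_sub_norm_cubeCoeff_le hW hW1 hd hΩ
  rw [Finset.sum_sub_distrib, Finset.sum_const, nsmul_eq_mul] at h2
  linarith

/-- Bessel's inequality for the accumulated spectral window. -/
lemma sum_norm_trigPoly_sq_le (hm : IsSlepianTapers Ω W m) (ξ : Fin d → ℝ) :
    ∑ k, ‖trigPoly (restrictSeq Ω (m k)) ξ‖ ^ 2 ≤ Ω.card := by
  -- The values m̂_k(ξ) are, up to conjugation, the coefficients of the conjugate exponential
  -- restricted to Ω, a vector of squared norm n_Ω.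
  have h := hm.orthonormal_restrictSeq.sum_inner_products_le
    (restrictSeq Ω fun q => starRingEnd ℂ (expo q ξ)) (s := Finset.univ)
  rw [norm_restrictSeq_sq] at h
  simp only [inner_restrictSeq, RCLike.norm_conj, norm_expo, one_pow, Finset.sum_const,
    nsmul_eq_mul, mul_one] at h
  refine le_trans (le_of_eq (Finset.sum_congr rfl fun k _ => ?_)) h
  rw [trigPoly_restrictSeq, ← RCLike.norm_conj, map_sum]
  congr 2
  exact Finset.sum_congr rfl fun q _ => by rw [map_mul, mul_comm]

end IsSlepianTapers

/-! ### Bias of a concentrated window -/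

lemma integral_cube_comp_neg (f : (Fin d → ℝ) → ℝ) (W : ℝ) :
    ∫ η in cube d W, f (-η) = ∫ η in cube d W, f η := by
  rw [← (Measure.measurePreserving_neg (volume : Measure (Fin d → ℝ))).setIntegral_preimage_emb
    (MeasurableEquiv.neg _).measurableEmbedding f]
  congr 2
  ext η
  simp [mem_cube]

/-- Smoothing a periodic `C²` function with a spectral window concentrated on a cube. -/
lemma abs_integral_window_sub_le {S ρ : (Fin d → ℝ) → ℝ} (hS : ContDiff ℝ 2 S)
    (hp : IsOnePeriodic S) {W : ℝ} (hW : 0 < W) (hW1 : W ≤ 1) (hρ : Continuous ρ)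
    (hρ0 : ∀ η, 0 ≤ ρ η) (hρW : ∀ η, ρ η ≤ (W ^ d)⁻¹) (hρ1 : ∫ η in cube d 1, ρ η = 1)
    (ξ : Fin d → ℝ) :
    |(∫ η in cube d 1, S (ξ - η) * ρ η) - S ξ|
      ≤ C2Norm S * (d ^ 2 * W ^ 2 + 4 * (1 - ∫ η in cube d W, ρ η)) := by
  set M := C2Norm S
  have hSb := abs_le_C2Norm hS hp
  have hSc : Continuous S := hS.continuous
  have hint : ∀ {f : (Fin d → ℝ) → ℝ}, Continuous f → ∀ V, IntegrableOn f (cube d V) :=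
    fun hf V => hf.continuousOn.integrableOn_compact (isCompact_cube V)
  set g : (Fin d → ℝ) → ℝ := fun η => S (ξ - η) - S ξ
  have hg : Continuous g := by fun_prop
  have hgb : ∀ η, |g η| ≤ 2 * M := fun η =>
    (abs_sub _ _).trans (by linarith [hSb (ξ - η), hSb ξ])
  have e1 : (∫ η in cube d 1, S (ξ - η) * ρ η) - S ξ = ∫ η in cube d 1, g η * ρ η := by
    have : ∀ η, g η * ρ η = S (ξ - η) * ρ η - S ξ * ρ η := fun η => sub_mul _ _ _
    simp only [this]
    rw [integral_sub (hint (by fun_prop) 1) (hint (by fun_prop) 1), integral_const_mul, hρ1,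
      mul_one]
  have hsub := cube_subset_cube_one (d := d) hW1
  have e2 : ∫ η in cube d 1, g η * ρ η
      = (∫ η in cube d 1 \ cube d W, g η * ρ η) + ∫ η in cube d W, g η * ρ η := by
    rw [setIntegral_sdiff (measurableSet_cube W) (hint (by fun_prop) 1) hsub, sub_add_cancel]
  have b1 : |∫ η in cube d 1 \ cube d W, g η * ρ η| ≤ 2 * M * (1 - ∫ η in cube d W, ρ η) := by
    have h1 : 1 - ∫ η in cube d W, ρ η = ∫ η in cube d 1 \ cube d W, ρ η := by
      rw [setIntegral_sdiff (measurableSet_cube W) (hint hρ 1) hsub, hρ1]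
    rw [h1, ← integral_const_mul, ← Real.norm_eq_abs]
    refine norm_integral_le_of_norm_le (((hint hρ 1).mono_set Set.sdiff_subset).const_mul _)
      (.of_forall fun η => ?_)
    rw [norm_mul, Real.norm_of_nonneg (hρ0 η)]
    exact mul_le_mul_of_nonneg_right (hgb η) (hρ0 η)
  set c := (W ^ d)⁻¹
  have hcW : c * volume.real (cube d W) = 1 := by
    rw [volume_real_cube hW.le]
    exact inv_mul_cancel₀ (by positivity)
  -- On the small cube ρ is compared with the constant density c = W^(-d).
  have e3 : ∫ η in cube d W, g η * ρ η
      = c * (∫ η in cube d W, g η) - ∫ η in cube d W, g η * (c - ρ η) := by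
    rw [← integral_const_mul, ← integral_sub (hint (by fun_prop) W) (hint (by fun_prop) W)]
    congr 1
    ext η
    ring
  -- Since ρ ≤ c here, |c - ρ| integrates without loss to 1 - ∫ ρ, the same deficiency as outside
  -- the cube; hence the total factor 4.
  have b2 : |∫ η in cube d W, g η * (c - ρ η)| ≤ 2 * M * (1 - ∫ η in cube d W, ρ η) := by
    have h1 : 1 - ∫ η in cube d W, ρ η = ∫ η in cube d W, (c - ρ η) := by
      rw [integral_sub (hint continuous_const W) (hint hρ W), setIntegral_const, smul_eq_mul,
        mul_comm, hcW]
    rw [h1, ← integral_const_mul, ← Real.norm_eq_abs]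
    refine norm_integral_le_of_norm_le ((hint (f := fun η => c - ρ η) (by fun_prop) W).const_mul _)
      (.of_forall fun η => ?_)
    rw [norm_mul, Real.norm_of_nonneg (sub_nonneg.2 (hρW η))]
    exact mul_le_mul_of_nonneg_right (hgb η) (sub_nonneg.2 (hρW η))
  -- The cube is symmetric, so g may be averaged with its reflection, leaving a second difference of
  -- S.
  have b3 : |c * ∫ η in cube d W, g η| ≤ d ^ 2 * M * W ^ 2 := by
    have h1 : ∫ η in cube d W, g η
        = ∫ η in cube d W, (1 / 2) * (S (ξ + η) + S (ξ - η) - 2 * S ξ) := by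
      have h2 : ∫ η in cube d W, g η = (1 / 2) * ((∫ η in cube d W, g (-η)) +
          ∫ η in cube d W, g η) := by
        rw [integral_cube_comp_neg]; ring
      rw [h2, ← integral_add (hint (by fun_prop) W) (hint hg W), ← integral_const_mul]
      congr 1
      ext η
      simp only [g, sub_neg_eq_add]
      ring
    have h3 : |∫ η in cube d W, g η| ≤ d ^ 2 * M * W ^ 2 * volume.real (cube d W) := by
      rw [h1, ← Real.norm_eq_abs]
      refine norm_setIntegral_le_of_norm_le_const (isCompact_cube W).measure_lt_top
        fun η hη => ?_
      rw [norm_mul, Real.norm_eq_abs, Real.norm_eq_abs, abs_of_pos (by norm_num)]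
      have h4 := abs_second_difference_le hS hp ξ η
      rw [cube_eq_closedBall hW.le, mem_closedBall_zero_iff] at hη
      have h5 : ‖η‖ ^ 2 ≤ W ^ 2 := by gcongr; linarith
      have h6 : 0 ≤ 2 * (d : ℝ) ^ 2 * M := mul_nonneg (by positivity) C2Norm_nonneg
      nlinarith [mul_le_mul_of_nonneg_left h5 h6]
    have hc : 0 < c := by positivity
    rw [abs_mul, abs_of_pos hc]
    calc c * |∫ η in cube d W, g η| ≤ c * (d ^ 2 * M * W ^ 2 * volume.real (cube d W)) := by
          gcongr
      _ = d ^ 2 * M * W ^ 2 * (c * volume.real (cube d W)) := by ring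
      _ = _ := by rw [hcW, mul_one]
  rw [e1, e2, e3]
  rw [abs_le] at *
  constructor <;> linarith [b1.1, b1.2, b2.1, b2.2, b3.1, b3.2]

/-! ### Gaussian moments -/

section Gaussian

/-- The fourth moment of a centred real Gaussian. -/
lemma integral_pow_four_gaussianReal (v : NNReal) :
    ∫ x, x ^ 4 ∂gaussianReal 0 v = 3 * (v : ℝ) ^ 2 := by
  -- The fourth moment is the fourth derivative at 0 of the moment generating function exp(vt²/2),
  -- computed below one derivative at a time.
  have h := iteratedDeriv_mgf_zero (X := fun x : ℝ => x) (μ := gaussianReal 0 v) (by simp) 4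
  rw [mgf_fun_id_gaussianReal] at h
  simp only [zero_mul, zero_add] at h
  have hE : ∀ t : ℝ, HasDerivAt (fun t : ℝ => Real.exp (v * t ^ 2 / 2))
      (v * t * Real.exp (v * t ^ 2 / 2)) t := by
    intro t
    have := (((hasDerivAt_id t).pow 2).const_mul (v : ℝ)).div_const 2 |>.exp
    refine this.congr_deriv ?_
    simp
    ring
  have d1 : deriv (fun t : ℝ => Real.exp (v * t ^ 2 / 2))
      = fun t => v * t * Real.exp (v * t ^ 2 / 2) := funext fun t => (hE t).deriv
  have d2 : deriv (fun t : ℝ => v * t * Real.exp (v * t ^ 2 / 2))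
      = fun t => (v + v ^ 2 * t ^ 2) * Real.exp (v * t ^ 2 / 2) := by
    ext t
    have := ((hasDerivAt_id t).const_mul (v : ℝ)).mul (hE t)
    refine (this.congr_deriv ?_).deriv
    simp
    ring
  have d3 : deriv (fun t : ℝ => (v + v ^ 2 * t ^ 2) * Real.exp (v * t ^ 2 / 2))
      = fun t => (3 * v ^ 2 * t + v ^ 3 * t ^ 3) * Real.exp (v * t ^ 2 / 2) := by
    ext t
    have := ((((hasDerivAt_id t).pow 2).const_mul ((v : ℝ) ^ 2)).const_add (v : ℝ)).mul (hE t)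
    refine (this.congr_deriv ?_).deriv
    simp
    ring
  have d4 : deriv (fun t : ℝ => (3 * v ^ 2 * t + v ^ 3 * t ^ 3) * Real.exp (v * t ^ 2 / 2)) 0
      = 3 * (v : ℝ) ^ 2 := by
    have := ((((hasDerivAt_id (0 : ℝ)).const_mul (3 * (v : ℝ) ^ 2)).add
      (((hasDerivAt_id (0 : ℝ)).pow 3).const_mul ((v : ℝ) ^ 3)))).mul (hE 0)
    refine (this.congr_deriv ?_).deriv
    simp
  rw [iteratedDeriv_succ', iteratedDeriv_succ', iteratedDeriv_succ', iteratedDeriv_one, d1, d2,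
    d3, d4] at h
  rw [h]
  rfl

variable {E : Type*} [MeasurableSpace E] {P : Measure E}

lemma integral_pow_four_of_hasGaussianLaw {Z : E → ℝ} (hZ : HasGaussianLaw Z P)
    (h0 : ∫ ω, Z ω ∂P = 0) : ∫ ω, Z ω ^ 4 ∂P = 3 * (∫ ω, Z ω ^ 2 ∂P) ^ 2 := by
  have := hZ.isProbabilityMeasure
  have hmap := hZ.map_eq_gaussianReal
  rw [h0] at hmap
  have h4 := integral_map (f := fun x : ℝ => x ^ 4) hZ.aemeasurable (by fun_prop)
  rw [← h4, hmap, integral_pow_four_gaussianReal, Real.coe_toNNReal _ (variance_nonneg _ _),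
    variance_of_integral_eq_zero hZ.aemeasurable h0]

/-- Isserlis' formula for a pair of squares. -/
lemma integral_sq_mul_sq {Z Z' : E → ℝ} (h : HasGaussianLaw Z P) (h' : HasGaussianLaw Z' P)
    (hadd : HasGaussianLaw (fun ω => Z ω + Z' ω) P)
    (hsub : HasGaussianLaw (fun ω => Z ω - Z' ω) P)
    (h0 : ∫ ω, Z ω ∂P = 0) (h0' : ∫ ω, Z' ω ∂P = 0) :
    Integrable (fun ω => Z ω ^ 2 * Z' ω ^ 2) P ∧ ∫ ω, Z ω ^ 2 * Z' ω ^ 2 ∂P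
      = (∫ ω, Z ω ^ 2 ∂P) * (∫ ω, Z' ω ^ 2 ∂P) + 2 * (∫ ω, Z ω * Z' ω ∂P) ^ 2 := by
  have i4 : ∀ {Y : E → ℝ}, HasGaussianLaw Y P → Integrable (fun ω => Y ω ^ 4) P := by
    intro Y hY
    have := (hY.memLp (p := 4) (by norm_num)).integrable_norm_pow (by norm_num)
    refine this.congr (.of_forall fun ω => ?_)
    simp only [Real.norm_eq_abs]
    exact Even.pow_abs (by decide) _
  have hmul : Integrable (fun ω => Z ω * Z' ω) P := h.memLp_two.integrable_mul h'.memLp_two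
  have hs := h.memLp_two.integrable_sq
  have hs' := h'.memLp_two.integrable_sq
  have hp : Integrable (fun ω => Z ω ^ 2 + 2 * (Z ω * Z' ω)) P := hs.add (hmul.const_mul 2)
  have hm : Integrable (fun ω => Z ω ^ 2 - 2 * (Z ω * Z' ω)) P := hs.sub (hmul.const_mul 2)
  have a1 := integral_pow_four_of_hasGaussianLaw hadd (by
    rw [integral_add h.integrable h'.integrable, h0, h0', add_zero])
  have a2 := integral_pow_four_of_hasGaussianLaw hsub (by
    rw [integral_sub h.integrable h'.integrable, h0, h0', sub_zero])
  have e1 : ∫ ω, (Z ω + Z' ω) ^ 2 ∂P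
      = (∫ ω, Z ω ^ 2 ∂P) + 2 * (∫ ω, Z ω * Z' ω ∂P) + ∫ ω, Z' ω ^ 2 ∂P := by
    rw [← integral_const_mul, ← integral_add hs (hmul.const_mul 2),
      ← integral_add hp hs']
    exact integral_congr_ae (.of_forall fun ω => by ring)
  have e2 : ∫ ω, (Z ω - Z' ω) ^ 2 ∂P
      = (∫ ω, Z ω ^ 2 ∂P) - 2 * (∫ ω, Z ω * Z' ω ∂P) + ∫ ω, Z' ω ^ 2 ∂P := by
    rw [← integral_const_mul, ← integral_sub hs (hmul.const_mul 2),
      ← integral_add hm hs']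
    exact integral_congr_ae (.of_forall fun ω => by ring)
  -- Polarization reduces the mixed moment to fourth powers of Gaussian variables.
  have hpt : ∀ ω, Z ω ^ 2 * Z' ω ^ 2 = (1 / 12) * ((Z ω + Z' ω) ^ 4 + (Z ω - Z' ω) ^ 4
      - 2 * Z ω ^ 4 - 2 * Z' ω ^ 4) := fun ω => by ring
  have j1 : Integrable (fun ω => (Z ω + Z' ω) ^ 4 + (Z ω - Z' ω) ^ 4) P := (i4 hadd).add (i4 hsub)
  have j2 : Integrable (fun ω => (Z ω + Z' ω) ^ 4 + (Z ω - Z' ω) ^ 4 - 2 * Z ω ^ 4) P :=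
    j1.sub ((i4 h).const_mul 2)
  have j3 : Integrable (fun ω => (Z ω + Z' ω) ^ 4 + (Z ω - Z' ω) ^ 4 - 2 * Z ω ^ 4
    - 2 * Z' ω ^ 4) P := j2.sub ((i4 h').const_mul 2)
  simp only [hpt]
  refine ⟨j3.const_mul _, ?_⟩
  rw [integral_const_mul]
  have e3 : ∫ ω, ((Z ω + Z' ω) ^ 4 + (Z ω - Z' ω) ^ 4 - 2 * Z ω ^ 4 - 2 * Z' ω ^ 4) ∂P
      = (∫ ω, (Z ω + Z' ω) ^ 4 ∂P) + (∫ ω, (Z ω - Z' ω) ^ 4 ∂P) - 2 * (∫ ω, Z ω ^ 4 ∂P)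
        - 2 * ∫ ω, Z' ω ^ 4 ∂P := by
    rw [← integral_const_mul, ← integral_const_mul, ← integral_add (i4 hadd) (i4 hsub),
      ← integral_sub j1 ((i4 h).const_mul 2), ← integral_sub j2 ((i4 h').const_mul 2)]
  rw [e3, a1, a2, integral_pow_four_of_hasGaussianLaw h h0,
    integral_pow_four_of_hasGaussianLaw h' h0', e1, e2]
  ring

/-- A linear statistic of the process. -/
def linStat (X : (Fin d → ℤ) → E → ℝ) (Ω : Finset (Fin d → ℤ)) (z : (Fin d → ℤ) → ℝ) : E → ℝ :=
  fun ω => ∑ q ∈ Ω, z q * X q ω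

/-- The covariance of two linear statistics. -/
def linCov (r : (Fin d → ℤ) → ℝ) (Ω : Finset (Fin d → ℤ)) (z z' : (Fin d → ℤ) → ℝ) : ℝ :=
  ∑ q ∈ Ω, ∑ q' ∈ Ω, z q * z' q' * r (q - q')

variable {X : (Fin d → ℤ) → E → ℝ} {r : (Fin d → ℤ) → ℝ}

namespace IsStationaryGaussian

lemma hasGaussianLaw_linStat (hX : IsStationaryGaussian P X r) (Ω : Finset (Fin d → ℤ))
    (z : (Fin d → ℤ) → ℝ) : HasGaussianLaw (linStat X Ω z) P := by
  have h := (hX.gaussian.hasGaussianLaw Ω).map_fun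
    (∑ q : Ω, z q.1 • ContinuousLinearMap.proj (R := ℝ) (φ := fun _ : Ω => ℝ) q)
  have heq : linStat X Ω z = fun ω =>
      (∑ q : Ω, z q.1 • ContinuousLinearMap.proj (R := ℝ) (φ := fun _ : Ω => ℝ) q)
        (Ω.restrict (X · ω)) := by
    ext ω
    rw [_root_.sum_apply]
    exact (Finset.sum_coe_sort Ω fun q => z q * X q ω).symm
  rwa [heq]

lemma integral_linStat (hX : IsStationaryGaussian P X r) (Ω : Finset (Fin d → ℤ))
    (z : (Fin d → ℤ) → ℝ) : ∫ ω, linStat X Ω z ω ∂P = 0 := by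
  simp only [linStat]
  rw [integral_finsetSum _ fun q _ =>
    ((hX.gaussian.hasGaussianLaw_eval q).integrable).const_mul _]
  simp [integral_const_mul, hX.mean_zero]

lemma integral_linStat_mul (hX : IsStationaryGaussian P X r) (Ω : Finset (Fin d → ℤ))
    (z z' : (Fin d → ℤ) → ℝ) :
    ∫ ω, linStat X Ω z ω * linStat X Ω z' ω ∂P = linCov r Ω z z' := by
  have hint : ∀ q q', Integrable (fun ω => X q ω * X q' ω) P := fun q q' =>
    (hX.gaussian.hasGaussianLaw_eval q).memLp_two.integrable_mul
      (hX.gaussian.hasGaussianLaw_eval q').memLp_two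
  have hpt : ∀ ω, linStat X Ω z ω * linStat X Ω z' ω
      = ∑ q ∈ Ω, ∑ q' ∈ Ω, z q * z' q' * (X q ω * X q' ω) := by
    intro ω
    simp only [linStat, Finset.sum_mul_sum]
    exact Finset.sum_congr rfl fun q _ => Finset.sum_congr rfl fun q' _ => by ring
  simp only [hpt]
  rw [integral_finsetSum _ fun q _ => integrable_finsetSum _ fun q' _ => (hint q q').const_mul _]
  refine Finset.sum_congr rfl fun q _ => ?_
  rw [integral_finsetSum _ fun q' _ => (hint q q').const_mul _]
  exact Finset.sum_congr rfl fun q' _ => by rw [integral_const_mul, hX.covariance]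

/-- Mean squared deviation of a sum of squares of linear statistics from a constant. -/
lemma integral_sum_sq_sub_sq (hX : IsStationaryGaussian P X r) [IsProbabilityMeasure P]
    (Ω : Finset (Fin d → ℤ)) {ι : Type*} [Fintype ι] (z : ι → (Fin d → ℤ) → ℝ) (a : ℝ) :
    Integrable (fun ω => (∑ i, linStat X Ω (z i) ω ^ 2 - a) ^ 2) P ∧
    ∫ ω, (∑ i, linStat X Ω (z i) ω ^ 2 - a) ^ 2 ∂P
      = (∑ i, linCov r Ω (z i) (z i) - a) ^ 2 + 2 * ∑ i, ∑ j, linCov r Ω (z i) (z j) ^ 2 := by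
  have hG := hX.hasGaussianLaw_linStat Ω
  have hpair : ∀ i j, Integrable
      (fun ω => linStat X Ω (z i) ω ^ 2 * linStat X Ω (z j) ω ^ 2) P ∧
      ∫ ω, linStat X Ω (z i) ω ^ 2 * linStat X Ω (z j) ω ^ 2 ∂P
        = linCov r Ω (z i) (z i) * linCov r Ω (z j) (z j) + 2 * linCov r Ω (z i) (z j) ^ 2 := by
    intro i j
    have hadd : HasGaussianLaw (fun ω => linStat X Ω (z i) ω + linStat X Ω (z j) ω) P := by
      convert hG (z i + z j) using 2 with ω
      simp only [linStat, Pi.add_apply, add_mul, Finset.sum_add_distrib]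
    have hsub : HasGaussianLaw (fun ω => linStat X Ω (z i) ω - linStat X Ω (z j) ω) P := by
      convert hG (z i - z j) using 2 with ω
      simp only [linStat, Pi.sub_apply, sub_mul, Finset.sum_sub_distrib]
    have h := integral_sq_mul_sq (hG (z i)) (hG (z j)) hadd hsub (hX.integral_linStat Ω _)
      (hX.integral_linStat Ω _)
    simp only [pow_two (linStat X Ω _ _), hX.integral_linStat_mul] at h ⊢
    exact h
  have hsq : ∀ i, Integrable (fun ω => linStat X Ω (z i) ω ^ 2) P :=
    fun i => (hG (z i)).memLp_two.integrable_sq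
  have hsqv : ∀ i, ∫ ω, linStat X Ω (z i) ω ^ 2 ∂P = linCov r Ω (z i) (z i) := by
    intro i
    simp only [pow_two, hX.integral_linStat_mul]
  have hpt : ∀ ω, (∑ i, linStat X Ω (z i) ω ^ 2 - a) ^ 2
      = ∑ i, ∑ j, linStat X Ω (z i) ω ^ 2 * linStat X Ω (z j) ω ^ 2
        - 2 * a * ∑ i, linStat X Ω (z i) ω ^ 2 + a ^ 2 := by
    intro ω
    rw [← Finset.sum_mul_sum]
    ring
  have j1 : Integrable (fun ω => ∑ i, ∑ j, linStat X Ω (z i) ω ^ 2 * linStat X Ω (z j) ω ^ 2) P :=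
    integrable_finsetSum _ fun i _ => integrable_finsetSum _ fun j _ => (hpair i j).1
  have j2 : Integrable (fun ω => 2 * a * ∑ i, linStat X Ω (z i) ω ^ 2) P :=
    (integrable_finsetSum _ fun i _ => hsq i).const_mul _
  simp only [hpt]
  have j3 : Integrable (fun ω => ∑ i, ∑ j, linStat X Ω (z i) ω ^ 2 * linStat X Ω (z j) ω ^ 2
      - 2 * a * ∑ i, linStat X Ω (z i) ω ^ 2) P := j1.sub j2
  refine ⟨j3.add (integrable_const _), ?_⟩
  rw [integral_add j3 (integrable_const _), integral_sub j1 j2, integral_const_mul,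
    integral_finsetSum _ fun i _ => hsq i, integral_finsetSum _ fun i _ =>
      integrable_finsetSum _ fun j _ => (hpair i j).1]
  have hin : ∀ i ∈ Finset.univ, ∫ ω, ∑ j, linStat X Ω (z i) ω ^ 2 * linStat X Ω (z j) ω ^ 2 ∂P
      = ∑ j, (linCov r Ω (z i) (z i) * linCov r Ω (z j) (z j)
        + 2 * linCov r Ω (z i) (z j) ^ 2) := by
    intro i _
    rw [integral_finsetSum _ fun j _ => (hpair i j).1]
    exact Finset.sum_congr rfl fun j _ => (hpair i j).2
  rw [Finset.sum_congr rfl hin]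
  simp only [hsqv, Finset.sum_add_distrib, ← Finset.mul_sum, ← Finset.sum_mul, integral_const,
    probReal_univ, one_smul]
  ring

end IsStationaryGaussian

end Gaussian

/-! ### Covariance operators and modulated tapers -/

/-- A Toeplitz operator with bounded symbol is bounded. -/
lemma norm_toeplitz_le {S : (Fin d → ℝ) → ℝ} (hS : Continuous S) {M : ℝ} (hM : ∀ x, |S x| ≤ M)
    {t : (Fin d → ℤ) → ℂ} (ht : ∀ q, t q = ∫ ξ in cube d 1, (S ξ : ℂ) * expo q ξ)
    (f : EuclideanSpace ℂ Ω) : ‖toeplitz Ω t f‖ ≤ M * ‖f‖ := by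
  have hM0 : 0 ≤ M := (abs_nonneg _).trans (hM 0)
  rcases eq_or_ne f 0 with rfl | hf
  · simp
  rcases eq_or_ne (toeplitz Ω t f) 0 with hg | hg
  · rw [hg, norm_zero]; positivity
  set g := toeplitz Ω t f
  have hfn : 0 < ‖f‖ := norm_pos_iff.2 hf
  have hgn : 0 < ‖g‖ := norm_pos_iff.2 hg
  have hSi : IntegrableOn (fun ξ => (S ξ : ℂ)) (cube d 1) :=
    (Complex.continuous_ofReal.comp hS).continuousOn.integrableOn_compact (isCompact_cube 1)
  have h1 : ‖g‖ ^ 2 = ‖(inner ℂ g (toeplitz Ω t f) : ℂ)‖ := by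
    rw [inner_self_eq_norm_sq_to_K]; simp
  -- Cauchy–Schwarz by weighted AM–GM; this weight makes both terms equal after integration, with
  -- sum 2‖f‖‖g‖.
  set s := ‖g‖ / ‖f‖
  have hs : 0 < s := by positivity
  have h2 : ‖(inner ℂ g (toeplitz Ω t f) : ℂ)‖
      ≤ ∫ ξ in cube d 1, M / 2 * (s * ‖trigPoly f ξ‖ ^ 2 + s⁻¹ * ‖trigPoly g ξ‖ ^ 2) := by
    rw [inner_toeplitz hSi ht f g]
    refine norm_integral_le_of_norm_le ((((integrableOn_norm_trigPoly_sq f 1).const_mul s).add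
      ((integrableOn_norm_trigPoly_sq g 1).const_mul s⁻¹)).const_mul _) (.of_forall fun ξ => ?_)
    rw [norm_mul, norm_mul, RCLike.norm_conj, Complex.norm_real, Real.norm_eq_abs]
    set a := ‖trigPoly f ξ‖
    set b := ‖trigPoly g ξ‖
    have h3 : 2 * (a * b) ≤ s * a ^ 2 + s⁻¹ * b ^ 2 := by
      have h4 : s * a ^ 2 + s⁻¹ * b ^ 2 - 2 * (a * b) = s⁻¹ * (s * a - b) ^ 2 := by
        field_simp
        ring
      have h5 : 0 ≤ s⁻¹ * (s * a - b) ^ 2 := by positivity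
      linarith
    have h6 : 0 ≤ a * b := by positivity
    calc |S ξ| * (a * b) ≤ M * (a * b) := by gcongr; exact hM ξ
      _ ≤ M / 2 * (s * a ^ 2 + s⁻¹ * b ^ 2) := by nlinarith
  rw [← h1, integral_const_mul, integral_add ((integrableOn_norm_trigPoly_sq f 1).const_mul s)
    ((integrableOn_norm_trigPoly_sq g 1).const_mul s⁻¹), integral_const_mul, integral_const_mul,
    integral_norm_trigPoly_sq, integral_norm_trigPoly_sq] at h2
  have h7 : M / 2 * (s * ‖f‖ ^ 2 + s⁻¹ * ‖g‖ ^ 2) = M * ‖f‖ * ‖g‖ := by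
    simp only [s]
    field_simp
    ring
  rw [h7, pow_two] at h2
  exact le_of_mul_le_mul_right h2 hgn

variable {r : (Fin d → ℤ) → ℝ} {S : (Fin d → ℝ) → ℝ}

/-- The covariance operator of a stationary process on `Ω`. -/
noncomputable def covOperator (r : (Fin d → ℤ) → ℝ) (Ω : Finset (Fin d → ℤ)) :
    EuclideanSpace ℂ Ω →ₗ[ℂ] EuclideanSpace ℂ Ω :=
  toeplitz Ω fun q => (r (-q) : ℂ)

lemma IsSpectralDensity.coeff_neg (hr : IsSpectralDensity S r) (q : Fin d → ℤ) :
    (r (-q) : ℂ) = ∫ ξ in cube d 1, (S ξ : ℂ) * expo q ξ := by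
  rw [hr.coeff, neg_neg]

lemma inner_covOperator (w v : (Fin d → ℤ) → ℂ) :
    inner ℂ (restrictSeq Ω w) (covOperator r Ω (restrictSeq Ω v))
      = ∑ q ∈ Ω, ∑ q' ∈ Ω, starRingEnd ℂ (w q) * v q' * (r (q - q') : ℂ) := by
  rw [PiLp.inner_apply, ← Finset.sum_coe_sort Ω]
  refine Finset.sum_congr rfl fun q _ => ?_
  rw [RCLike.inner_apply, covOperator, toeplitz_apply, ← Finset.sum_coe_sort Ω, Finset.sum_mul]
  refine Finset.sum_congr rfl fun q' _ => ?_
  rw [neg_sub]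
  change _ * v q' * starRingEnd ℂ (w q) = _
  ring

/-- Real and imaginary parts of the tapers need not be orthonormal. Against a real z, however, one
complex coefficient carries both covariances, so Bessel's inequality for the complex family applies.
-/
lemma norm_inner_covOperator_ofReal_sq (w : (Fin d → ℤ) → ℂ) (z : (Fin d → ℤ) → ℝ) :
    ‖(inner ℂ (restrictSeq Ω w) (covOperator r Ω (restrictSeq Ω fun q => (z q : ℂ))) : ℂ)‖ ^ 2
      = linCov r Ω (fun q => (w q).re) z ^ 2 + linCov r Ω (fun q => (w q).im) z ^ 2 := by
  have h : inner ℂ (restrictSeq Ω w) (covOperator r Ω (restrictSeq Ω fun q => (z q : ℂ)))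
      = (⟨linCov r Ω (fun q => (w q).re) z, -linCov r Ω (fun q => (w q).im) z⟩ : ℂ) := by
    rw [inner_covOperator]
    apply Complex.ext <;>
    simp [linCov, Complex.re_sum, Complex.im_sum]
  rw [h, ← Complex.normSq_eq_norm_sq, Complex.normSq_mk]
  ring

lemma re_inner_covOperator_self (w : (Fin d → ℤ) → ℂ) :
    (inner ℂ (restrictSeq Ω w) (covOperator r Ω (restrictSeq Ω w))).re
      = linCov r Ω (fun q => (w q).re) (fun q => (w q).re)
        + linCov r Ω (fun q => (w q).im) (fun q => (w q).im) := by
  rw [inner_covOperator]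
  simp only [linCov, Complex.re_sum, ← Finset.sum_add_distrib]
  refine Finset.sum_congr rfl fun q _ => Finset.sum_congr rfl fun q' _ => ?_
  simp
  ring

/-- The real and imaginary parts of a family of complex sequences. -/
def reIm {κ : Type*} (w : κ → (Fin d → ℤ) → ℂ) : κ ⊕ κ → (Fin d → ℤ) → ℝ :=
  Sum.elim (fun k q => (w k q).re) (fun k q => (w k q).im)

/-- Bessel's inequality for the covariances of the real and imaginary parts of an orthonormal
family. -/
lemma sum_linCov_sq_le (hr : IsSpectralDensity S r) (hS : Continuous S) {M : ℝ}
    (hM : ∀ x, |S x| ≤ M) {K : ℕ} {w : Fin K → (Fin d → ℤ) → ℂ}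
    (hw : Orthonormal ℂ fun k => restrictSeq Ω (w k)) :
    ∑ i, ∑ j, linCov r Ω (reIm w i) (reIm w j) ^ 2 ≤ M ^ 2 * K := by
  have hM0 : 0 ≤ M := (abs_nonneg _).trans (hM 0)
  have h1 : ∀ z : (Fin d → ℤ) → ℝ, ∑ i, linCov r Ω (reIm w i) z ^ 2
      ≤ M ^ 2 * ∑ q ∈ Ω, z q ^ 2 := by
    intro z
    have hB := hw.sum_inner_products_le (covOperator r Ω (restrictSeq Ω fun q => (z q : ℂ)))
      (s := Finset.univ)
    simp only [norm_inner_covOperator_ofReal_sq] at hB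
    rw [Fintype.sum_sum_type, ← Finset.sum_add_distrib]
    refine hB.trans ?_
    have h2 : ‖restrictSeq Ω fun q => (z q : ℂ)‖ ^ 2 = ∑ q ∈ Ω, z q ^ 2 := by
      rw [norm_restrictSeq_sq]
      simp
    rw [← h2, ← mul_pow]
    gcongr
    exact norm_toeplitz_le hS hM hr.coeff_neg _
  -- Bessel's inequality is used in one index for a fixed second index j; the squared norms of the
  -- real and imaginary parts then sum to K.
  rw [Finset.sum_comm]
  refine (Finset.sum_le_sum fun j _ => h1 (reIm w j)).trans (le_of_eq ?_)
  rw [← Finset.mul_sum, Fintype.sum_sum_type, ← Finset.sum_add_distrib]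
  congr 1
  have h3 : ∀ k ∈ Finset.univ, ∑ q ∈ Ω, reIm w (Sum.inl k) q ^ 2
      + ∑ q ∈ Ω, reIm w (Sum.inr k) q ^ 2 = 1 := by
    intro k _
    have h4 := norm_restrictSeq_sq (Ω := Ω) (w k)
    rw [hw.1 k, one_pow] at h4
    rw [h4, ← Finset.sum_add_distrib]
    refine Finset.sum_congr rfl fun q _ => ?_
    rw [← Complex.normSq_eq_norm_sq, Complex.normSq_apply]
    simp only [reIm, Sum.elim_inl, Sum.elim_inr]
    ring
  rw [Finset.sum_congr rfl h3]
  simp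

/-- The modulated tapers at frequency `ξ`, conjugated. -/
noncomputable def modulated (m : (Fin d → ℤ) → ℂ) (ξ : Fin d → ℝ) : (Fin d → ℤ) → ℂ :=
  fun q => starRingEnd ℂ (m q * expo q ξ)

lemma taperedPeriodogram_eq {E : Type*} (X : (Fin d → ℤ) → E → ℝ) (m : (Fin d → ℤ) → ℂ)
    (ξ : Fin d → ℝ) (ω : E) : taperedPeriodogram Ω m (fun q => X q ω) ξ
      = linStat X Ω (fun q => (modulated m ξ q).re) ω ^ 2
        + linStat X Ω (fun q => (modulated m ξ q).im) ω ^ 2 := by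
  rw [taperedPeriodogram, ← RCLike.norm_conj, map_sum, ← Complex.normSq_eq_norm_sq,
    Complex.normSq_apply, Complex.re_sum, Complex.im_sum, pow_two, pow_two]
  have h : ∀ q, starRingEnd ℂ (m q * (X q ω : ℂ) * expo q ξ) = modulated m ξ q * (X q ω : ℂ) := by
    intro q
    simp only [modulated, map_mul, Complex.conj_ofReal]
    ring
  simp only [h, Complex.re_mul_ofReal, Complex.im_mul_ofReal, linStat]

/-- The conjugation in the modulated taper is what gives the argument ξ - η, so that the expectation
is a genuine convolution. -/
lemma trigPoly_modulated (m : (Fin d → ℤ) → ℂ) (ξ η : Fin d → ℝ) :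
    trigPoly (restrictSeq Ω (modulated m ξ)) η
      = starRingEnd ℂ (trigPoly (restrictSeq Ω m) (ξ - η)) := by
  rw [trigPoly_restrictSeq, trigPoly_restrictSeq, map_sum]
  refine Finset.sum_congr rfl fun q _ => ?_
  rw [expo_arg_sub, modulated]
  simp only [map_mul, Complex.conj_conj]
  ring

/-- The expected tapered periodogram is a smoothing of the spectral density. -/
lemma re_inner_covOperator_modulated (hr : IsSpectralDensity S r) (hp : IsOnePeriodic S)
    (m : (Fin d → ℤ) → ℂ) (ξ : Fin d → ℝ) :
    (inner ℂ (restrictSeq Ω (modulated m ξ))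
        (covOperator r Ω (restrictSeq Ω (modulated m ξ)))).re
      = ∫ η in cube d 1, S (ξ - η) * ‖trigPoly (restrictSeq Ω m) η‖ ^ 2 := by
  rw [covOperator, inner_toeplitz (w := fun ξ => (S ξ : ℂ)) hr.integrable.ofReal hr.coeff_neg]
  have h1 : ∀ η, (S η : ℂ) * (trigPoly (restrictSeq Ω (modulated m ξ)) η
      * starRingEnd ℂ (trigPoly (restrictSeq Ω (modulated m ξ)) η))
      = ((S η * ‖trigPoly (restrictSeq Ω m) (ξ - η)‖ ^ 2 : ℝ) : ℂ) := by
    intro η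
    rw [Complex.mul_conj, Complex.normSq_eq_norm_sq, trigPoly_modulated, RCLike.norm_conj]
    push_cast
    rfl
  simp only [h1]
  -- The reflection η ↦ ξ - η moves the shift from the window to S; periodicity restores the
  -- original cube.
  rw [integral_complex_ofReal, Complex.ofReal_re,
    ← setIntegral_cube_one_comp_sub (f := fun η => S (ξ - η) * ‖trigPoly (restrictSeq Ω m) η‖ ^ 2)
      (fun x k => ?_) ξ]
  · simp only [sub_sub_cancel]
  · have h2 := hp (ξ - x) (-k)
    have h3 : ξ - (x + fun j => (k j : ℝ)) = ξ - x + fun j => ((-k) j : ℝ) := by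
      ext j
      simp
      ring
    rw [trigPoly_periodic, h3, h2]

lemma orthonormal_modulated {K : ℕ} {m : Fin K → (Fin d → ℤ) → ℂ}
    (hm : Orthonormal ℂ fun k => restrictSeq Ω (m k)) (ξ : Fin d → ℝ) :
    Orthonormal ℂ fun k => restrictSeq Ω (modulated (m k) ξ) := by
  rw [orthonormal_iff_ite] at *
  intro k l
  have h := hm l k
  rw [inner_restrictSeq] at h ⊢
  simp only [eq_comm (a := l)] at h
  rw [← h]
  refine Finset.sum_congr rfl fun q _ => ?_
  have h1 : expo q ξ * starRingEnd ℂ (expo q ξ) = 1 := by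
    rw [Complex.mul_conj, Complex.normSq_eq_norm_sq, norm_expo]
    simp
  simp only [modulated, map_mul, Complex.conj_conj]
  linear_combination (starRingEnd ℂ (m l q) * m k q) * h1

/-! ### Assembling the mean squared error -/

/-- Bias-variance bound for the multitaper estimator. -/
lemma mse_le_of_bandwidth {E : Type*} [MeasurableSpace E] {P : Measure E} [IsProbabilityMeasure P]
    {X : (Fin d → ℤ) → E → ℝ} {K : ℕ} {W : ℝ} {m : Fin K → (Fin d → ℤ) → ℂ}
    (hd : 1 ≤ d) (hX : IsStationaryGaussian P X r) (hr : IsSpectralDensity S r)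
    (hp : IsOnePeriodic S) (hS : ContDiff ℝ 2 S) (hK : 1 ≤ K) (hW : 0 < W)
    (hKW : K = ⌈(Ω.card : ℝ) * W ^ d⌉₊) (hm : IsSlepianTapers Ω W m) (ξ : Fin d → ℝ) :
    Integrable (sqError X S Ω m ξ) P ∧
    ∫ ω, sqError X S Ω m ξ ω ∂P ≤ C2Norm S ^ 2 * ((d ^ 2 * W ^ 2 + 4 * ((1 +
      6 * d * W ^ (d - 1) * (digitalPerimeter Ω *
        (1 + Real.posLog (Ω.card / digitalPerimeter Ω)))) / K)) ^ 2 + 2 / K) := by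
  have hK0 : (0 : ℝ) < K := by exact_mod_cast hK
  have hΩ : Ω.Nonempty := Finset.card_pos.1 (hK.trans hm.card_le)
  have hn : (0 : ℝ) < Ω.card := by exact_mod_cast hΩ.card_pos
  have hK1 : (Ω.card : ℝ) * W ^ d ≤ K := by rw [hKW]; exact Nat.le_ceil _
  have hW1 := hm.bandwidth_le_one hd hΩ hK1
  have hM0 : 0 ≤ C2Norm S := C2Norm_nonneg
  set w : Fin K → (Fin d → ℤ) → ℂ := fun k => modulated (m k) ξ
  have hw := orthonormal_modulated hm.orthonormal_restrictSeq ξ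
  have herr : sqError X S Ω m ξ = fun ω => (1 / (K : ℝ) ^ 2) *
      (∑ i, linStat X Ω (reIm w i) ω ^ 2 - K * S ξ) ^ 2 := by
    ext ω
    have h1 : ∑ k, taperedPeriodogram Ω (m k) (fun q => X q ω) ξ
        = ∑ i, linStat X Ω (reIm w i) ω ^ 2 := by
      rw [Fintype.sum_sum_type, ← Finset.sum_add_distrib]
      exact Finset.sum_congr rfl fun k _ => taperedPeriodogram_eq X (m k) ξ ω
    rw [sqError, multitaper, h1, sq_abs]
    field_simp
  obtain ⟨hint, hval⟩ := hX.integral_sum_sq_sub_sq Ω (reIm w) (K * S ξ)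
  rw [herr]
  refine ⟨hint.const_mul _, ?_⟩
  rw [integral_const_mul, hval]
  set ρ : (Fin d → ℝ) → ℝ := fun η =>
    (1 / (K : ℝ)) * ∑ k, ‖trigPoly (restrictSeq Ω (m k)) η‖ ^ 2
  have hρc : Continuous ρ := continuous_const.mul
    (continuous_finsetSum _ fun k _ => (continuous_trigPoly _).norm.pow 2)
  -- Bessel gives ρ ≤ n_Ω/K, and rounding K upwards makes n_Ω/K ≤ W^(-d).
  have hρW : ∀ η, ρ η ≤ (W ^ d)⁻¹ := by
    intro η
    have h1 := hm.sum_norm_trigPoly_sq_le η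
    calc ρ η ≤ 1 / K * Ω.card := mul_le_mul_of_nonneg_left h1 (by positivity)
      _ ≤ (W ^ d)⁻¹ := by
        rw [← one_div, one_div_mul_eq_div, div_le_div_iff₀ hK0 (by positivity)]
        linarith
  have hρint : ∀ V, ∫ η in cube d V, ρ η
      = (1 / (K : ℝ)) * ∑ k, ∫ η in cube d V, ‖trigPoly (restrictSeq Ω (m k)) η‖ ^ 2 := by
    intro V
    rw [integral_const_mul, integral_finsetSum _ fun k _ => integrableOn_norm_trigPoly_sq _ V]
  have hρ1 : ∫ η in cube d 1, ρ η = 1 := by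
    rw [hρint]
    simp only [integral_norm_trigPoly_sq, hm.orthonormal_restrictSeq.1]
    simp [hK0.ne']
  have hdef : 1 - ∫ η in cube d W, ρ η
      = (∑ k, (1 - concentration Ω W (m k))) / K := by
    rw [hρint]
    simp only [← concentration_eq, Finset.sum_sub_distrib]
    simp only [Finset.sum_const, Finset.card_univ, Fintype.card_fin, nsmul_eq_mul, mul_one]
    field_simp
  have hbias := abs_integral_window_sub_le hS hp hW hW1 hρc (fun η => by positivity) hρW hρ1 ξ
  have hmean : ∑ i, linCov r Ω (reIm w i) (reIm w i) = K * ∫ η in cube d 1, S (ξ - η) * ρ η := by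
    have h1 : ∀ η, S (ξ - η) * ρ η = (1 / (K : ℝ)) * ∑ k,
        S (ξ - η) * ‖trigPoly (restrictSeq Ω (m k)) η‖ ^ 2 := by
      intro η
      rw [← Finset.mul_sum]
      simp only [ρ]
      ring
    have hSi : ∀ k, IntegrableOn (fun η => S (ξ - η) * ‖trigPoly (restrictSeq Ω (m k)) η‖ ^ 2)
        (cube d 1) := fun k => by
      have h2 := continuous_trigPoly (restrictSeq Ω (m k))
      have h3 := hS.continuous
      exact (by fun_prop : Continuous fun η => S (ξ - η) *
        ‖trigPoly (restrictSeq Ω (m k)) η‖ ^ 2).continuousOn.integrableOn_compact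
          (isCompact_cube 1)
    simp only [h1]
    rw [integral_const_mul, integral_finsetSum _ fun k _ => hSi k, ← mul_assoc,
      mul_one_div_cancel hK0.ne', one_mul, Fintype.sum_sum_type, ← Finset.sum_add_distrib]
    refine Finset.sum_congr rfl fun k _ => ?_
    rw [← re_inner_covOperator_modulated hr hp]
    exact (re_inner_covOperator_self _).symm
  have hvar := sum_linCov_sq_le hr hS.continuous (abs_le_C2Norm hS hp) hw
  rw [hdef] at hbias
  have hdefect := hm.sum_one_sub_concentration_le hd hΩ hK hW hKW
  have hb2 : ((∫ η in cube d 1, S (ξ - η) * ρ η) - S ξ) ^ 2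
      ≤ (C2Norm S * (d ^ 2 * W ^ 2 + 4 * ((1 + 6 * d * W ^ (d - 1) * (digitalPerimeter Ω *
        (1 + Real.posLog (Ω.card / digitalPerimeter Ω)))) / K))) ^ 2 := by
    refine sq_le_sq' ?_ ?_
    · refine le_trans ?_ (neg_le_of_abs_le hbias)
      rw [neg_le_neg_iff]
      gcongr
    · refine (le_of_abs_le hbias).trans ?_
      gcongr
  rw [hmean]
  calc 1 / (K : ℝ) ^ 2 * ((K * (∫ η in cube d 1, S (ξ - η) * ρ η) - K * S ξ) ^ 2
        + 2 * ∑ i, ∑ j, linCov r Ω (reIm w i) (reIm w j) ^ 2)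
      ≤ 1 / (K : ℝ) ^ 2 * ((K * (∫ η in cube d 1, S (ξ - η) * ρ η) - K * S ξ) ^ 2
        + 2 * (C2Norm S ^ 2 * K)) := by gcongr
    _ = ((∫ η in cube d 1, S (ξ - η) * ρ η) - S ξ) ^ 2 + C2Norm S ^ 2 * (2 / K) := by
        field_simp
    _ ≤ _ := by
        rw [mul_add, ← mul_pow]
        exact add_le_add_left hb2 _

/-- Applied with a = d and e = 1/K. By Cauchy–Schwarz the three squares get coefficients 3a⁴, 3·4² =
48 and 3·24²a² = 1728a²; as e² ≤ e, the 48 joins the variance's 2 to give 50. -/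
lemma sq_add_le_of_sq_le_self {a x y e : ℝ} (he : 0 ≤ e) (hee : e ^ 2 ≤ e) :
    (a ^ 2 * x + 4 * e + 24 * a * y) ^ 2 + 2 * e
      ≤ (3 * a ^ 4 + 1728 * a ^ 2 + 50) * (x ^ 2 + y ^ 2 + e) := by
  have hcs : (a ^ 2 * x + 4 * e + 24 * a * y) ^ 2
      ≤ 3 * ((a ^ 2 * x) ^ 2 + (4 * e) ^ 2 + (24 * a * y) ^ 2) := by
    linarith [sq_nonneg (a ^ 2 * x - 4 * e), sq_nonneg (4 * e - 24 * a * y),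
      sq_nonneg (a ^ 2 * x - 24 * a * y)]
  have p1 : 0 ≤ a ^ 4 * (y ^ 2 + e) := by positivity
  have p2 : 0 ≤ a ^ 2 * (x ^ 2 + e) := by positivity
  have p3 : 0 ≤ x ^ 2 + y ^ 2 := by positivity
  linarith

/-- The mean squared error bound in terms of the number of tapers. -/
lemma mse_le {E : Type*} [MeasurableSpace E] {P : Measure E} [IsProbabilityMeasure P]
    {X : (Fin d → ℤ) → E → ℝ} {K : ℕ} {W : ℝ} {m : Fin K → (Fin d → ℤ) → ℂ}
    (hd : 1 ≤ d) (hX : IsStationaryGaussian P X r) (hr : IsSpectralDensity S r)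
    (hp : IsOnePeriodic S) (hS : ContDiff ℝ 2 S) (hK : 1 ≤ K) (hW : 0 < W)
    (hKW : K = ⌈(Ω.card : ℝ) * W ^ d⌉₊) (hm : IsSlepianTapers Ω W m) (ξ : Fin d → ℝ) :
    Integrable (sqError X S Ω m ξ) P ∧
    ∫ ω, sqError X S Ω m ξ ω ∂P ≤ (3 * d ^ 4 + 1728 * d ^ 2 + 50) * C2Norm S ^ 2 *
      ((K : ℝ) ^ (4 / (d : ℝ)) / (Ω.card : ℝ) ^ (4 / (d : ℝ))
        + digitalPerimeter Ω ^ 2 /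
            ((Ω.card : ℝ) ^ (2 - 2 / (d : ℝ)) * (K : ℝ) ^ (2 / (d : ℝ)))
          * (1 + Real.posLog ((Ω.card : ℝ) / digitalPerimeter Ω)) ^ 2
        + 1 / (K : ℝ)) := by
  obtain ⟨hint, hle⟩ := mse_le_of_bandwidth hd hX hr hp hS hK hW hKW hm ξ
  refine ⟨hint, hle.trans ?_⟩
  have hK0 : (0 : ℝ) < K := by exact_mod_cast hK
  have hK1' : (1 : ℝ) ≤ K := by exact_mod_cast hK
  have hΩ : Ω.Nonempty := Finset.card_pos.1 (hK.trans hm.card_le)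
  have hn : (0 : ℝ) < Ω.card := by exact_mod_cast hΩ.card_pos
  have hK1 : (Ω.card : ℝ) * W ^ d ≤ K := by rw [hKW]; exact Nat.le_ceil _
  have hp1 := one_le_digitalPerimeter hd hΩ
  have hL : 0 ≤ Real.posLog ((Ω.card : ℝ) / digitalPerimeter Ω) := Real.posLog_nonneg
  set n : ℝ := (Ω.card : ℝ)
  set p := digitalPerimeter Ω
  set L := 1 + Real.posLog (n / p)
  have hd0 : (d : ℝ) ≠ 0 := by positivity
  set k : ℝ := (K : ℝ) ^ (1 / (d : ℝ))
  set v : ℝ := n ^ (1 / (d : ℝ))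
  have hk : 0 < k := by positivity
  have hv : 0 < v := by positivity
  have hroot : ∀ {x : ℝ}, 0 < x → ∀ i : ℕ, x ^ ((i : ℝ) / d) = (x ^ (1 / (d : ℝ))) ^ i := by
    intro x hx i
    rw [← Real.rpow_natCast, ← Real.rpow_mul hx.le]
    congr 1
    ring
  have ek4 : (K : ℝ) ^ (4 / (d : ℝ)) = k ^ 4 := by simpa only [Nat.cast_ofNat] using hroot hK0 4
  have ev4 : n ^ (4 / (d : ℝ)) = v ^ 4 := by simpa only [Nat.cast_ofNat] using hroot hn 4
  have ek2 : (K : ℝ) ^ (2 / (d : ℝ)) = k ^ 2 := by simpa only [Nat.cast_ofNat] using hroot hK0 2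
  have ev2 : n ^ (2 - 2 / (d : ℝ)) = n ^ 2 / v ^ 2 := by
    rw [Real.rpow_sub hn, Real.rpow_two]
    congr 1
    simpa only [Nat.cast_ofNat] using hroot hn 2
  have ekd : k ^ d = K := by
    rw [← hroot hK0 d, div_self hd0, Real.rpow_one]
  have evd : v ^ d = n := by
    rw [← hroot hn d, div_self hd0, Real.rpow_one]
  have hWa : W ≤ k / v := by
    refine le_of_pow_le_pow_left₀ (n := d) (by omega) (by positivity) ?_
    rw [div_pow, ekd, evd, le_div_iff₀ hn]
    linarith
  have hx : W ^ 2 ≤ k ^ 2 / v ^ 2 := by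
    rw [← div_pow]
    gcongr
  -- Here k/v = (K/n)^(1/d), so (k/v)^(d-1) equals (K/n)/(k/v), that is, K v/(n k).
  have hy : W ^ (d - 1) / K ≤ v / (n * k) := by
    have h1 : (k / v) ^ (d - 1) * (k / v) = K / n := by
      rw [pow_sub_one_mul (by omega), div_pow, ekd, evd]
    have h2 : (k / v) ^ (d - 1) = K * (v / (n * k)) := by
      rw [← eq_div_iff (by positivity)] at h1
      rw [h1]
      field_simp
    rw [div_le_iff₀ hK0, mul_comm, ← h2]
    gcongr
  rw [ek4, ev4, ek2, ev2]
  have hdn : (0 : ℝ) ≤ d := by positivity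
  have hL0 : 0 ≤ L := by positivity
  have hmain : d ^ 2 * W ^ 2 + 4 * ((1 + 6 * d * W ^ (d - 1) * (p * L)) / K)
      ≤ d ^ 2 * (k ^ 2 / v ^ 2) + 4 * (1 / K) + 24 * d * (p * (v / (n * k)) * L) := by
    have h1 : 4 * ((1 + 6 * d * W ^ (d - 1) * (p * L)) / K)
        = 4 * (1 / K) + 24 * d * (p * (W ^ (d - 1) / K) * L) := by ring
    rw [h1, ← add_assoc]
    gcongr
  set x := k ^ 2 / v ^ 2
  set y := p * (v / (n * k)) * L
  have hx4 : k ^ 4 / v ^ 4 = x ^ 2 := by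
    simp only [x, div_pow]
    ring
  have hy2 : p ^ 2 / (n ^ 2 / v ^ 2 * k ^ 2) * L ^ 2 = y ^ 2 := by
    simp only [y]
    field_simp
  rw [hx4, hy2]
  have hsq : (d ^ 2 * W ^ 2 + 4 * ((1 + 6 * d * W ^ (d - 1) * (p * L)) / K)) ^ 2
      ≤ (d ^ 2 * x + 4 * (1 / K) + 24 * d * y) ^ 2 := by
    gcongr
  have hinv : (1 / (K : ℝ)) ^ 2 ≤ 1 / K := by
    have h1 : 1 / (K : ℝ) ≤ 1 := by rw [div_le_one hK0]; exact hK1'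
    have h2 : 0 < 1 / (K : ℝ) := by positivity
    nlinarith
  have h3 : (2 : ℝ) / K = 2 * (1 / K) := by ring
  rw [h3]
  have hKi : 0 < 1 / (K : ℝ) := by positivity
  set e := 1 / (K : ℝ)
  rw [mul_comm (3 * (d : ℝ) ^ 4 + 1728 * (d : ℝ) ^ 2 + 50), mul_assoc (C2Norm S ^ 2)]
  refine mul_le_mul_of_nonneg_left ?_ (sq_nonneg _)
  exact (add_le_add_left hsq _).trans (sq_add_le_of_sq_le_self hKi.le hinv)

/-- In dimension two, the error bound simplifies in the fine-scale regime. -/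
lemma fine_scale_bound_le {A n p K : ℝ} (hn : 2 ≤ n) (hp1 : 1 ≤ p) (hp : p ≤ A * Real.sqrt n)
    (hK : n ^ (2 / 3 : ℝ) ≤ K) (hK' : K ≤ n ^ (2 / 3 : ℝ) + 1) :
    K ^ 2 / n ^ 2 + p ^ 2 / (n * K) * (1 + Real.posLog (n / p)) ^ 2 + 1 / K
      ≤ (20 + 9 * A ^ 2) * (n ^ (-(2 / 3) : ℝ) * Real.log n ^ 2) := by
  have hn0 : 0 < n := by linarith
  set s := n ^ (2 / 3 : ℝ)
  have hs1 : 1 ≤ s := Real.one_le_rpow (by linarith) (by norm_num)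
  have hs0 : 0 < s := by linarith
  have hK0 : 0 < K := by linarith
  have he : n ^ (-(2 / 3) : ℝ) = 1 / s := by rw [Real.rpow_neg hn0.le, one_div]
  have hs3 : s ^ 3 = n ^ 2 := by
    rw [← Real.rpow_natCast, ← Real.rpow_mul hn0.le, ← Real.rpow_natCast]
    norm_num
  -- For n ≥ 2 constants are absorbed via 1 ≤ 4 log² n. The first and last terms contribute 4 + 1,
  -- hence 20; the 9 comes from 1 + log₊(n/p) ≤ 3 log n, where p ≥ 1.
  have hlog : 1 / 2 ≤ Real.log n := by
    have h1 := Real.log_two_gt_d9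
    have h2 := Real.log_le_log (by norm_num) hn
    linarith
  have hlog2 : 1 ≤ 4 * Real.log n ^ 2 := by nlinarith
  have hL : 1 + Real.posLog (n / p) ≤ 3 * Real.log n := by
    have h1 : Real.posLog (n / p) ≤ Real.log n := by
      refine max_le (by linarith) (Real.log_le_log (by positivity) ?_)
      exact div_le_self hn0.le hp1
    linarith
  have hL0 : 0 ≤ 1 + Real.posLog (n / p) := add_nonneg zero_le_one Real.posLog_nonneg
  rw [he]
  have t1 : K ^ 2 / n ^ 2 ≤ 4 * (1 / s) := by
    rw [← hs3, mul_one_div, div_le_div_iff₀ (by positivity) hs0]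
    have h1 : K ^ 2 ≤ (2 * s) ^ 2 := by gcongr; linarith
    nlinarith
  have t2 : p ^ 2 / (n * K) ≤ A ^ 2 * (1 / s) := by
    have h1 : p ^ 2 ≤ A ^ 2 * n := by
      calc p ^ 2 ≤ (A * Real.sqrt n) ^ 2 := by gcongr
        _ = A ^ 2 * n := by rw [mul_pow, Real.sq_sqrt hn0.le]
    calc p ^ 2 / (n * K) ≤ (A ^ 2 * n) / (n * s) := by gcongr
      _ = A ^ 2 * (1 / s) := by field_simp
  have t3 : 1 / K ≤ 1 / s := by gcongr
  have t4 : (1 + Real.posLog (n / p)) ^ 2 ≤ 9 * Real.log n ^ 2 := by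
    calc (1 + Real.posLog (n / p)) ^ 2 ≤ (3 * Real.log n) ^ 2 := by gcongr
      _ = _ := by ring
  have hi : 0 < 1 / s := by positivity
  calc K ^ 2 / n ^ 2 + p ^ 2 / (n * K) * (1 + Real.posLog (n / p)) ^ 2 + 1 / K
      ≤ 4 * (1 / s) + A ^ 2 * (1 / s) * (9 * Real.log n ^ 2) + 1 / s := by gcongr
    _ ≤ _ := by nlinarith

end Multitaper

theorem mainTheorem2 :
    (∀ d : ℕ, 1 ≤ d → ∃ C : ℝ, 0 < C ∧
      ∀ {E : Type*} [MeasurableSpace E] (P : Measure E) [IsProbabilityMeasure P]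
        (X : (Fin d → ℤ) → E → ℝ) (r : (Fin d → ℤ) → ℝ) (S : (Fin d → ℝ) → ℝ)
        (Ω : Finset (Fin d → ℤ)) (K : ℕ) (W : ℝ) (m : Fin K → (Fin d → ℤ) → ℂ)
        (ξ : Fin d → ℝ),
        Multitaper.IsStationaryGaussian P X r →
        Multitaper.IsSpectralDensity S r →
        Multitaper.IsOnePeriodic S →
        ContDiff ℝ 2 S →
        1 ≤ K →
        0 < W →
        K = ⌈(Ω.card : ℝ) * W ^ d⌉₊ →
        Multitaper.IsSlepianTapers Ω W m →
        (2 ≤ d → (Ω.card : ℝ) ≤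
          (K : ℝ) * Multitaper.digitalPerimeter Ω ^ ((d : ℝ) / ((d : ℝ) - 1))) →
        Integrable (Multitaper.sqError X S Ω m ξ) P ∧
        ∫ ω, Multitaper.sqError X S Ω m ξ ω ∂P ≤
          C * Multitaper.C2Norm S ^ 2 *
            ((K : ℝ) ^ (4 / (d : ℝ)) / (Ω.card : ℝ) ^ (4 / (d : ℝ))
              + Multitaper.digitalPerimeter Ω ^ 2 /
                  ((Ω.card : ℝ) ^ (2 - 2 / (d : ℝ)) * (K : ℝ) ^ (2 / (d : ℝ)))
                * (1 + Real.posLog ((Ω.card : ℝ) / Multitaper.digitalPerimeter Ω)) ^ 2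
              + 1 / (K : ℝ)))
    ∧
    (∀ A : ℝ, 0 < A → ∃ C : ℝ, 0 < C ∧
      ∀ {E : Type*} [MeasurableSpace E] (P : Measure E) [IsProbabilityMeasure P]
        (X : (Fin 2 → ℤ) → E → ℝ) (r : (Fin 2 → ℤ) → ℝ) (S : (Fin 2 → ℝ) → ℝ)
        (Ω : Finset (Fin 2 → ℤ)) (K : ℕ) (W : ℝ) (m : Fin K → (Fin 2 → ℤ) → ℂ)
        (ξ : Fin 2 → ℝ),
        Multitaper.IsStationaryGaussian P X r →
        Multitaper.IsSpectralDensity S r →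
        Multitaper.IsOnePeriodic S →
        ContDiff ℝ 2 S →
        2 ≤ Ω.card →
        Multitaper.digitalPerimeter Ω ≤ A * Real.sqrt (Ω.card : ℝ) →
        K = ⌈(Ω.card : ℝ) ^ (2 / 3 : ℝ)⌉₊ →
        0 < W →
        K = ⌈(Ω.card : ℝ) * W ^ 2⌉₊ →
        Multitaper.IsSlepianTapers Ω W m →
        Integrable (Multitaper.sqError X S Ω m ξ) P ∧
        ∫ ω, Multitaper.sqError X S Ω m ξ ω ∂P ≤
          C * (Ω.card : ℝ) ^ (-(2 / 3) : ℝ) * Real.log (Ω.card : ℝ) ^ 2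
            * Multitaper.C2Norm S ^ 2) := by
  refine ⟨fun d hd => ⟨3 * (d : ℝ) ^ 4 + 1728 * (d : ℝ) ^ 2 + 50, by positivity, ?_⟩,
    fun A _ => ⟨(3 * (2 : ℝ) ^ 4 + 1728 * (2 : ℝ) ^ 2 + 50) * (20 + 9 * A ^ 2), by positivity, ?_⟩⟩
  · intro E _ P _ X r S Ω K W m ξ hX hr hp hS hK hW hKW hm _
    exact Multitaper.mse_le hd hX hr hp hS hK hW hKW hm ξ
  · intro E _ P _ X r S Ω K W m ξ hX hr hp hS hn hper hK hW hKW hm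
    have hn' : (2 : ℝ) ≤ Ω.card := by exact_mod_cast hn
    have hK1 : 1 ≤ K := by
      rw [hK, Nat.one_le_ceil_iff]
      positivity
    have hΩ : Ω.Nonempty := Finset.card_pos.1 (by omega)
    obtain ⟨hint, hle⟩ := Multitaper.mse_le (d := 2) (by norm_num) hX hr hp hS hK1 hW hKW hm ξ
    refine ⟨hint, hle.trans ?_⟩
    have hb := Multitaper.fine_scale_bound_le hn'
      (Multitaper.one_le_digitalPerimeter (by norm_num) hΩ) hper (K := K)
      (by rw [hK]; exact Nat.le_ceil _)
      (by rw [hK]; exact (Nat.ceil_lt_add_one (by positivity)).le)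
    -- For d = 2 the exponents 4/d, 2 - 2/d and 2/d become 2, 1 and 1.
    have e1 : (4 : ℝ) / ((2 : ℕ) : ℝ) = (2 : ℕ) := by norm_num
    have e2 : (2 : ℝ) - 2 / ((2 : ℕ) : ℝ) = 1 := by norm_num
    have e3 : (2 : ℝ) / ((2 : ℕ) : ℝ) = 1 := by norm_num
    rw [e1, e2, e3, Real.rpow_one, Real.rpow_one, Real.rpow_natCast, Real.rpow_natCast]
    refine (mul_le_mul_of_nonneg_left hb (by positivity)).trans (le_of_eq ?_)
    push_cast
    ring
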